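/- **Setting.** Let $d\ge 1$, let $\Omega\subset\mathbb{R}^d$ be compact and convex with non-empty interior $\Omega^\circ$, and let $p_0,p_1$ be probability densities on $\Omega$ (with respect to Lebesgue measure) that are continuous on $\Omega$ and bounded away from zero there. For $z\in\Omega^\circ$ and $t\in[0,1]$ put $S_t(z)=\{\delta\in\mathbb{R}^d:\ z-t\delta\in\Omega,\ z+(1-t)\delta\in\Omega\}$ and $$v(t,z)=\mathbb{E}[X_1-X_0\mid (1-t)X_0+tX_1=z]=\frac{\int_{S_t(z)}\delta\,p_0(z-t\delta)\,p_1(z+(1-t)\delta)\,d\delta}{\int_{S_t(z)}p_0(z-t\delta)\,p_1(z+(1-t)\delta)\,d\delta},$$ where $X_0\sim p_0$ and $X_1\sim p_1$ are independent. For $\eta\ge 0$ put $$\omega(\eta)=\sup_{z,z'\in\Omega,\ \|z-z'\|\le\eta}\max\left\{\left|\frac{p_0(z)}{p_0(z')}-1\right|,\left|\frac{p_1(z)}{p_1(z')}-1\right|\right\},\qquad \omega^{-1}(1)=\sup\{\eta\in[0,\mathrm{diam}(\Omega)]:\ \omega(\eta)\le 1\}.$$ Let $\Psi:(0,\infty)\to\mathbb{R}$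 be any antiderivative of $u\mapsto 1/(u+\omega(u))$ and assume the Osgood condition $\Psi(u)\to-\infty$ as $u\downarrow 0$. (Then $\Psi$ is a bijection onto $\mathbb{R}$ with inverse $\Psi^{-1}$; at $\eta=0$ the right-hand sides of the bounds (1) and (2) below are read as $0$, their limit as $\eta\downarrow0$.) For $x\in\Omega^\circ$ let $t\mapsto\mathfrak{R}(t,x)$ be the unique solution of $$\mathfrak{R}(t,x)=x+\int_0^t v(s,\mathfrak{R}(s,x))\,ds,\qquad t\in[0,1],$$ with $\mathfrak{R}(t,x)\in\Omega^\circ$ for $t\in[0,1)$. For $\varepsilon,\gamma>0$ put $\Omega^{-\varepsilon}=\{x:\ \overline{B}(x,\varepsilon)\subseteq\Omega\}$, with $\overline{B}(x,\varepsilon)$ the closed Euclidean ball, and $\mathcal{A}_\gamma=\{x\in\Omega:\ \mathrm{dist}(\mathfrak{R}(1,x),\partial\Omega)\le\gamma\}$. **Theorem.** Such a solution $\mathfrak{R}(\cdot,x)$ exists and is unique for every $x\in\Omega^\circ$. There are constants $\mathfrak{C}_1,\mathfrak{C}_2>0$ and $\mathfrak{K}_1,\mathfrak{K}_2,\mathfrak{K}_3>0$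 that depend only on $d$, $\mathrm{diam}(\Omega)$ and $\omega^{-1}(1)$ such that for every $\varepsilon>0$: (i) $x\mapsto\mathfrak{R}(t,x)$ is uniformly continuous on $\Omega^{-\varepsilon}$, uniformly in $t\in[0,1]$. Indeed, for all $\eta\ge0$, all $t\in[0,1]$ and all $x,x'\in\Omega^{-\varepsilon}$ with $\|x-x'\|\le\eta$, $$\|\mathfrak{R}(t,x)-\mathfrak{R}(t,x')\|\le\Psi^{-1}\!\left(\frac{\Psi(\eta)}{2}+\mathfrak{C}_1+\frac{\mathfrak{C}_2}{\varepsilon}\ln\frac{\mathrm{diam}(\Omega)}{\varepsilon}\right)+\mathrm{diam}(\Omega)\max\left\{\frac{4\mathfrak{C}_2}{2\mathfrak{C}_2-\varepsilon\Psi(\eta)},\ \frac{\eta}{\Psi^{-1}(-2\mathfrak{C}_2/\varepsilon)}\right\}.\tag{1}$$ (If $2\mathfrak{C}_2=\varepsilon\Psi(\eta)$, the first entry of the maximum is omitted.) (ii) For all $\gamma\in(0,\mathrm{diam}(\Omega)/2]$, $\eta\ge0$, $t\in[0,1]$ and $x,x'\in\Omega^{-\varepsilon}\setminus\mathcal{A}_\gamma$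 with $\|x-x'\|\le\eta$, $$\|\mathfrak{R}(t,x)-\mathfrak{R}(t,x')\|\le\Psi^{-1}\big(\Psi(\eta)+Q\big),\qquad Q=\mathfrak{K}_1+\frac{\mathfrak{K}_2}{\min\{\varepsilon,\gamma\}}\ln\frac{\mathrm{diam}(\Omega)}{\varepsilon}+\frac{\mathfrak{K}_3}{\varepsilon\gamma}.\tag{2}$$ If moreover $\omega(\eta)\le L\eta$ for all $\eta\ge0$ with some $L\ge0$, then $\|\mathfrak{R}(t,x)-\mathfrak{R}(t,x')\|\le e^{(1+L)Q}\|x-x'\|$ for all $t\in[0,1]$ and $x,x'\in\Omega^{-\varepsilon}\setminus\mathcal{A}_\gamma$. In particular, if $p_0$ and $p_1$ are Lipschitz on $\Omega$, then $x\mapsto\mathfrak{R}(t,x)$ is Lipschitz on $\Omega^{-\varepsilon}\setminus\mathcal{A}_\gamma$, with a constant that does not depend on $t$. -/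

import Mathlib

open Set Filter Topology MeasureTheory

noncomputable section

namespace RectifiedFlow

/-- Euclidean space `ℝ^d`. -/
abbrev E (d : ℕ) : Type := EuclideanSpace ℝ (Fin d)

variable {d : ℕ}

/-- `A^{-ε}`: the points whose closed `ε`-ball is contained in `A`. -/
def erosion (A : Set (E d)) (ε : ℝ) : Set (E d) :=
  {x | Metric.closedBall x ε ⊆ A}

/-- `p` (restricted to `Ω`) is a probability density with respect to Lebesgue measure on `Ω`
that is continuous on `Ω` and bounded away from zero on `Ω`. Values of `p` off `Ω` are never used.
(For compact `Ω`, boundedness from above is automatic.) -/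
structure IsRegularDensity (Ω : Set (E d)) (p : E d → ℝ) : Prop where
  continuousOn : ContinuousOn p Ω
  bounded_below : ∃ c : ℝ, 0 < c ∧ ∀ x ∈ Ω, c ≤ p x
  integral_eq_one : ∫ x in Ω, p x = 1

/-- `S_t(z)`: the displacements `δ = x₁ - x₀` with `x₀, x₁ ∈ Ω` and `(1 - t) x₀ + t x₁ = z`. -/
def displacements (Ω : Set (E d)) (t : ℝ) (z : E d) : Set (E d) :=
  {δ | z - t • δ ∈ Ω ∧ z + (1 - t) • δ ∈ Ω}

/-- The velocity field `v(t, z) = E[X₁ - X₀ | (1 - t) X₀ + t X₁ = z]` for independent `X₀`, `X₁`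
with densities `p₀`, `p₁` on `Ω`: the mean of `δ` under the conditional density of `X₁ - X₀`
given `X_t = z`, which is proportional to `p₀(z - tδ) p₁(z + (1-t)δ)` on `S_t(z)`. -/
def velocity (Ω : Set (E d)) (p₀ p₁ : E d → ℝ) (t : ℝ) (z : E d) : E d :=
  (∫ δ in displacements Ω t z, p₀ (z - t • δ) * p₁ (z + (1 - t) • δ))⁻¹ •
    ∫ δ in displacements Ω t z, (p₀ (z - t • δ) * p₁ (z + (1 - t) • δ)) • δ

/-- `z` is a Carathéodory solution on `[0, 1]` of `z' = v(t, z)`, `z(0) = x`. As `v` is only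
considered on the interior of `Ω`, the path has to lie there for all times `t < 1`. -/
structure IsRectifiedPath (Ω : Set (E d)) (p₀ p₁ : E d → ℝ) (x : E d) (z : ℝ → E d) : Prop where
  mem_interior : ∀ t ∈ Ico (0 : ℝ) 1, z t ∈ interior Ω
  integrable : IntervalIntegrable (fun s => velocity Ω p₀ p₁ s (z s)) volume 0 1
  integral_eq : ∀ t ∈ Icc (0 : ℝ) 1, z t = x + ∫ s in (0 : ℝ)..t, velocity Ω p₀ p₁ s (z s)

/-- The rectified flow `ℜ(t, x)`: the position at time `t` of the solution started at `x`. -/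
def rectifiedFlow (Ω : Set (E d)) (p₀ p₁ : E d → ℝ) (t : ℝ) (x : E d) : E d :=
  Classical.epsilon (IsRectifiedPath Ω p₀ p₁ x) t

/-- `ω(η)`: the joint modulus of relative continuity of the two densities. -/
def omega (Ω : Set (E d)) (p₀ p₁ : E d → ℝ) (η : ℝ) : ℝ :=
  sSup {r | ∃ z ∈ Ω, ∃ z' ∈ Ω, ‖z - z'‖ ≤ η ∧
    r = max |p₀ z / p₀ z' - 1| |p₁ z / p₁ z' - 1|}

/-- `ω⁻¹(1)`: the generalized inverse at `1` of `ω` on `[0, diam Ω]`. -/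
def omegaInvOne (Ω : Set (E d)) (p₀ p₁ : E d → ℝ) : ℝ :=
  sSup {η | η ∈ Icc 0 (Metric.diam Ω) ∧ omega Ω p₀ p₁ η ≤ 1}

/-- `Ψ(u) = ∫ du / (u + ω(u))`, the antiderivative on `(0, ∞)` that vanishes at `a`. -/
def Psi (Ω : Set (E d)) (p₀ p₁ : E d → ℝ) (a u : ℝ) : ℝ :=
  ∫ s in a..u, (s + omega Ω p₀ p₁ s)⁻¹

/-- The inverse of `Ψ : (0, ∞) → ℝ`. -/
def PsiInv (Ω : Set (E d)) (p₀ p₁ : E d → ℝ) (a y : ℝ) : ℝ :=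
  Function.invFunOn (Psi Ω p₀ p₁ a) (Ioi 0) y

/-- `𝒜_γ`: the starting points whose final position is within `γ` of the boundary. -/
def nearBoundary (Ω : Set (E d)) (p₀ p₁ : E d → ℝ) (γ : ℝ) : Set (E d) :=
  {x ∈ Ω | Metric.infDist (rectifiedFlow Ω p₀ p₁ 1 x) (frontier Ω) ≤ γ}

/-- The modulus of continuity of the flow on `Ω^{-ε}`. At `η = 0`, where `Ψ(0) = -∞`,
it is read as its limit `0`. -/
def globalModulus (Ω : Set (E d)) (p₀ p₁ : E d → ℝ) (a C₁ C₂ ε η : ℝ) : ℝ :=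
  open Classical in
  if η = 0 then 0 else
    PsiInv Ω p₀ p₁ a
        (Psi Ω p₀ p₁ a η / 2 + C₁ + C₂ / ε * Real.log (Metric.diam Ω / ε)) +
      Metric.diam Ω *
        max (4 * C₂ / (2 * C₂ - ε * Psi Ω p₀ p₁ a η)) (η / PsiInv Ω p₀ p₁ a (-2 * C₂ / ε))

/-- The exponent `C₁ + C₂ / min(ε, γ) * ln(diam Ω / ε) + C₃ / (ε γ)`. -/
def awayExponent (Ω : Set (E d)) (C₁ C₂ C₃ ε γ : ℝ) : ℝ :=
  C₁ + C₂ / min ε γ * Real.log (Metric.diam Ω / ε) + C₃ / (ε * γ)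

/-- The modulus of continuity of the flow on `Ω^{-ε} \ 𝒜_γ`. At `η = 0`, where `Ψ(0) = -∞`,
it is read as its limit `0`. -/
def awayModulus (Ω : Set (E d)) (p₀ p₁ : E d → ℝ) (a C₁ C₂ C₃ ε γ η : ℝ) : ℝ :=
  open Classical in
  if η = 0 then 0 else
    PsiInv Ω p₀ p₁ a (Psi Ω p₀ p₁ a η + awayExponent Ω C₁ C₂ C₃ ε γ)

end RectifiedFlow

end

/-!
Given `X_t = z`, the displacement `X₁ - X₀` has a density proportional to
`p₀(z - tδ) p₁(z + (1-t)δ)` on `S_t(z)`. If `z` and `z'` have distance at least `ρ` from the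
boundary, then `S_t(z)` and `S_t(z')` are contained in dilates of each other by the factor
`1 + ‖z - z'‖ / ρ`, and the densities differ by a relative error of order `ω(‖z - z'‖)`. Hence, at
distance `ρ` from the boundary, the velocity has the modulus of continuity
`K (1 + 1/ρ) (u + ω(u))`.

Paths approach the boundary at a controlled rate. The conditional mean `m = z + (1-t) v(t, z)` of
`X₁` lies in `Ω`, and the equation `dz/dt = v(t, z)` says that `d/dt (z / (1-t)) = m / (1-t)²`.
Therefore `z(t)` is a convex combination of its starting point `x`, with weight `1 - t`, and a
point of `Ω`, and it keeps the fraction `1 - t` of the distance of `x` from the boundary.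

Up to any time before `1`, Osgood's inequality now gives uniqueness, stability, and, through
Picard iteration for `z / (1-t)`, existence. The bound degenerates at time `1`, so one stops at a
time `1 - τ`, uses that the speed is at most `diam Ω` afterwards, and optimizes `τ`. If moreover
the final position has distance more than `γ` from the boundary, then the path has distance at
least a constant multiple of `γ ε / diam Ω` from it at every time, and no stopping is needed.
-/

noncomputable section

namespace RectifiedFlow

/-! ### Primitives of functions on an interval -/

section Primitive

variable {F : Type*} [NormedAddCommGroup F] {f : ℝ → F} {t T : ℝ}

lemma intervalIntegrable_zero_of_continuousOn (hf : ContinuousOn f (Icc 0 T)) (ht : t ∈ Icc 0 T) :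
    IntervalIntegrable f volume 0 t :=
  (hf.mono (Icc_subset_Icc_right ht.2)).intervalIntegrable_of_Icc ht.1

variable [NormedSpace ℝ F]

lemma continuousOn_integral_zero (hf : IntegrableOn f (Icc 0 T)) :
    ContinuousOn (fun t => ∫ s in (0 : ℝ)..t, f s) (Icc 0 T) := by
  rcases lt_or_ge T 0 with hT | hT
  · simp [Icc_eq_empty hT.not_ge]
  have h := intervalIntegral.continuousOn_primitive_interval (μ := volume) (uIcc_of_le hT ▸ hf)
  rwa [uIcc_of_le hT] at h

lemma hasDerivAt_integral_zero [CompleteSpace F] (hf : ContinuousOn f (Icc 0 T))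
    (ht : t ∈ Ioo 0 T) : HasDerivAt (fun t => ∫ s in (0 : ℝ)..t, f s) (f t) t :=
  intervalIntegral.integral_hasDerivAt_right
    (intervalIntegrable_zero_of_continuousOn hf (Ioo_subset_Icc_self ht))
    ((hf.mono Ioo_subset_Icc_self).stronglyMeasurableAtFilter isOpen_Ioo _ ht)
    (hf.continuousAt (Icc_mem_nhds ht.1 ht.2))

end Primitive

/-! ### Osgood's inequality -/

/-- A modulus of continuity `φ`, extended monotonically to negative arguments. It is the right-hand
side of the scalar comparison equation `u' = K φ(u)`. -/
structure IsModulus (φ : ℝ → ℝ) : Prop where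
  continuous : Continuous φ
  monotone : Monotone φ
  map_zero : φ 0 = 0
  pos : ∀ ⦃s⦄, 0 < s → 0 < φ s

/-- The primitive of `1 / φ` on `(0, ∞)` that vanishes at `a`. Osgood's condition says that it tends
to `-∞` at `0`. -/
def osgoodPrimitive (φ : ℝ → ℝ) (a u : ℝ) : ℝ := ∫ s in a..u, (φ s)⁻¹

namespace IsModulus

variable {φ : ℝ → ℝ} (hφ : IsModulus φ) {a u v : ℝ}
include hφ

lemma nonneg (hu : 0 ≤ u) : 0 ≤ φ u := hφ.map_zero.symm.trans_le (hφ.monotone hu)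

lemma continuousOn_inv : ContinuousOn (fun s => (φ s)⁻¹) (Ioi 0) :=
  hφ.continuous.continuousOn.inv₀ fun _ hs => (hφ.pos hs).ne'

lemma intervalIntegrable_inv (hu : 0 < u) (hv : 0 < v) :
    IntervalIntegrable (fun s => (φ s)⁻¹) volume u v :=
  (hφ.continuousOn_inv.mono fun _ hs => (lt_min hu hv).trans_le hs.1).intervalIntegrable

lemma hasDerivAt_osgoodPrimitive (ha : 0 < a) (hu : 0 < u) :
    HasDerivAt (osgoodPrimitive φ a) (φ u)⁻¹ u :=
  intervalIntegral.integral_hasDerivAt_right (hφ.intervalIntegrable_inv ha hu)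
    (hφ.continuousOn_inv.stronglyMeasurableAtFilter isOpen_Ioi _ hu)
    (hφ.continuousOn_inv.continuousAt (Ioi_mem_nhds hu))

lemma continuousOn_osgoodPrimitive (ha : 0 < a) : ContinuousOn (osgoodPrimitive φ a) (Ioi 0) :=
  fun _ hu => (hφ.hasDerivAt_osgoodPrimitive ha hu).continuousAt.continuousWithinAt

lemma strictMonoOn_osgoodPrimitive (ha : 0 < a) :
    StrictMonoOn (osgoodPrimitive φ a) (Ioi 0) := by
  refine strictMonoOn_of_deriv_pos (convex_Ioi 0) (hφ.continuousOn_osgoodPrimitive ha)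
    fun u hu => ?_
  rw [interior_Ioi] at hu
  rw [(hφ.hasDerivAt_osgoodPrimitive ha hu).deriv]
  exact inv_pos.2 (hφ.pos hu)

lemma osgoodPrimitive_sub (ha : 0 < a) (hu : 0 < u) (hv : 0 < v) :
    osgoodPrimitive φ a v - osgoodPrimitive φ a u = ∫ s in u..v, (φ s)⁻¹ :=
  intervalIntegral.integral_interval_sub_left (hφ.intervalIntegrable_inv ha hv)
    (hφ.intervalIntegrable_inv ha hu)

lemma log_div_le_osgoodPrimitive_sub {L : ℝ} (ha : 0 < a) (hu : 0 < u) (huv : u ≤ v)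
    (hL : ∀ s ∈ Icc u v, φ s ≤ L * s) :
    Real.log (v / u) / L ≤ osgoodPrimitive φ a v - osgoodPrimitive φ a u := by
  have hv := hu.trans_le huv
  rw [hφ.osgoodPrimitive_sub ha hu hv, ← integral_inv_of_pos hu hv,
    ← intervalIntegral.integral_div]
  refine intervalIntegral.integral_mono_on huv ?_ (hφ.intervalIntegrable_inv hu hv) fun s hs => ?_
  · exact ((continuousOn_id.inv₀ fun s hs =>
      ((lt_min hu hv).trans_le hs.1).ne').div_const _).intervalIntegrable
  · rw [div_eq_mul_inv, ← mul_inv, mul_comm]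
    exact inv_anti₀ (hφ.pos (hu.trans_le hs.1)) (hL s hs)

lemma tendsto_osgoodPrimitive_atTop {L : ℝ} (ha : 0 < a) (hu : 0 < u)
    (hL : ∀ s ∈ Ici u, φ s ≤ L * s) : Tendsto (osgoodPrimitive φ a) atTop atTop := by
  have hL0 : 0 < L := pos_of_mul_pos_left ((hφ.pos hu).trans_le (hL u self_mem_Ici)) hu.le
  have hlog : Tendsto (fun v => Real.log (v / u) / L + osgoodPrimitive φ a u) atTop atTop :=
    tendsto_atTop_add_const_right _ _ <| Tendsto.atTop_div_const hL0 <|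
      Real.tendsto_log_atTop.comp (tendsto_id.atTop_div_const hu)
  refine tendsto_atTop_mono' _ ?_ hlog
  filter_upwards [eventually_ge_atTop u] with v hv
  exact le_sub_iff_add_le.1 <|
    hφ.log_div_le_osgoodPrimitive_sub ha hu hv fun s hs => hL s hs.1

lemma surjOn_osgoodPrimitive (ha : 0 < a) (hbot : Tendsto (osgoodPrimitive φ a) (𝓝[>] 0) atBot)
    (htop : Tendsto (osgoodPrimitive φ a) atTop atTop) :
    SurjOn (osgoodPrimitive φ a) (Ioi 0) univ := by
  intro y _
  obtain ⟨u, hu, hu0⟩ :=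
    ((hbot.eventually (eventually_le_atBot y)).and self_mem_nhdsWithin).exists
  obtain ⟨v, hv, hv0⟩ :=
    ((htop.eventually (eventually_ge_atTop y)).and (eventually_gt_atTop 0)).exists
  exact isPreconnected_Ioi.intermediate_value hu0 hv0 (hφ.continuousOn_osgoodPrimitive ha) ⟨hu, hv⟩

lemma osgoodPrimitive_le_add_mul {G G' : ℝ → ℝ} {K T : ℝ} (ha : 0 < a)
    (hG : ContinuousOn G (Icc 0 T)) (hpos : ∀ t ∈ Icc 0 T, 0 < G t)
    (hderiv : ∀ t ∈ Ioo 0 T, HasDerivAt G (G' t) t) (hle : ∀ t ∈ Ioo 0 T, G' t ≤ K * φ (G t)) :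
    ∀ t ∈ Icc 0 T, osgoodPrimitive φ a (G t) ≤ osgoodPrimitive φ a (G 0) + K * t := by
  intro t ht
  have hcomp : ∀ s ∈ Ioo 0 T,
      HasDerivAt (osgoodPrimitive φ a ∘ G) ((φ (G s))⁻¹ * G' s) s := fun s hs =>
    (hφ.hasDerivAt_osgoodPrimitive ha (hpos s (Ioo_subset_Icc_self hs))).comp s (hderiv s hs)
  have hbound : osgoodPrimitive φ a (G t) - osgoodPrimitive φ a (G 0) ≤ K * (t - 0) := by
    refine (convex_Icc 0 T).image_sub_le_mul_sub_of_deriv_le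
      ((hφ.continuousOn_osgoodPrimitive ha).comp hG hpos) (fun s hs => ?_) (fun s hs => ?_)
      0 (left_mem_Icc.2 (ht.1.trans ht.2)) t ht ht.1
    all_goals rw [interior_Icc] at hs
    · exact (hcomp s hs).differentiableAt.differentiableWithinAt
    · rw [(hcomp s hs).deriv, inv_mul_le_iff₀ (hφ.pos (hpos s (Ioo_subset_Icc_self hs))), mul_comm]
      exact hle s hs
  linarith

theorem osgood_inequality {h : ℝ → ℝ} {η K T : ℝ} (ha : 0 < a) (hη : 0 < η) (hK : 0 ≤ K)
    (hc : ContinuousOn h (Icc 0 T)) (hnonneg : ∀ t ∈ Icc 0 T, 0 ≤ h t)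
    (hle : ∀ t ∈ Icc 0 T, h t ≤ η + K * ∫ s in (0 : ℝ)..t, φ (h s))
    {r : ℝ} (hr : 0 < r) (hηr : osgoodPrimitive φ a η + K * T ≤ osgoodPrimitive φ a r) :
    ∀ t ∈ Icc 0 T, h t ≤ r := by
  intro t ht
  let G : ℝ → ℝ := fun t => η + K * ∫ s in (0 : ℝ)..t, φ (h s)
  have hφh : ContinuousOn (fun s => φ (h s)) (Icc 0 T) := hφ.continuous.comp_continuousOn hc
  have hG : ContinuousOn G (Icc 0 T) := continuousOn_const.add <|
    continuousOn_const.mul (continuousOn_integral_zero hφh.integrableOn_Icc)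
  have hηG : ∀ t ∈ Icc 0 T, η ≤ G t := fun t ht => le_add_of_nonneg_right <|
    mul_nonneg hK <| intervalIntegral.integral_nonneg ht.1 fun s hs =>
      hφ.nonneg (hnonneg s ⟨hs.1, hs.2.trans ht.2⟩)
  have hderiv : ∀ t ∈ Ioo 0 T, HasDerivAt G (K * φ (h t)) t := fun t ht =>
    ((hasDerivAt_integral_zero hφh ht).const_mul K).const_add η
  have hcompare := hφ.osgoodPrimitive_le_add_mul ha hG (fun s hs => hη.trans_le (hηG s hs)) hderiv
    (fun s hs => mul_le_mul_of_nonneg_left (hφ.monotone (hle s (Ioo_subset_Icc_self hs))) hK) t ht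
  have hG0 : G 0 = η := by simp [G]
  refine (hle t ht).trans <|
    ((hφ.strictMonoOn_osgoodPrimitive ha).le_iff_le (hη.trans_le (hηG t ht)) hr).1 ?_
  calc osgoodPrimitive φ a (G t) ≤ osgoodPrimitive φ a η + K * t := hG0 ▸ hcompare
    _ ≤ osgoodPrimitive φ a η + K * T := by gcongr; exact ht.2
    _ ≤ osgoodPrimitive φ a r := hηr

end IsModulus

lemma exists_pos_add_le_of_tendsto_atBot {f : ℝ → ℝ} (hf : Tendsto f (𝓝[>] 0) atBot) (Q y : ℝ) :
    ∃ η > 0, f η + Q ≤ y := by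
  obtain ⟨η, hη, hη0⟩ :=
    ((hf.eventually (eventually_le_atBot (y - Q))).and self_mem_nhdsWithin).exists
  exact ⟨η, hη0, le_sub_iff_add_le.1 hη⟩

lemma IsModulus.eq_zero_of_le_integral {φ : ℝ → ℝ} (hφ : IsModulus φ) {a : ℝ} (ha : 0 < a)
    (hbot : Tendsto (osgoodPrimitive φ a) (𝓝[>] 0) atBot) {h : ℝ → ℝ} {K T : ℝ} (hK : 0 ≤ K)
    (hc : ContinuousOn h (Icc 0 T)) (hnonneg : ∀ t ∈ Icc 0 T, 0 ≤ h t)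
    (hle : ∀ t ∈ Icc 0 T, h t ≤ K * ∫ s in (0 : ℝ)..t, φ (h s)) :
    ∀ t ∈ Icc 0 T, h t = 0 := by
  intro t ht
  refine le_antisymm (le_of_forall_pos_le_add fun r hr => ?_) (hnonneg t ht)
  obtain ⟨η, hη, hηr⟩ := exists_pos_add_le_of_tendsto_atBot hbot (K * T) (osgoodPrimitive φ a r)
  rw [zero_add]
  exact hφ.osgood_inequality ha hη hK hc hnonneg
    (fun s hs => (hle s hs).trans (le_add_of_nonneg_left hη.le)) hr hηr t ht

/-! ### Picard iteration under Osgood's condition -/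

/-- The majorants of the distances between the `n`-th Picard iterates of two paths: they start from
the a priori bound `B` and are iterated through the comparison equation `u' = K φ(u)`. -/
def picardMajorant (φ : ℝ → ℝ) (K B : ℝ) : ℕ → ℝ → ℝ
  | 0, _ => B
  | n + 1, t => min B (K * ∫ s in (0 : ℝ)..t, φ (picardMajorant φ K B n s))

namespace IsModulus

variable {φ : ℝ → ℝ} (hφ : IsModulus φ) {K B : ℝ}

omit hφ in
lemma picardMajorant_le (n : ℕ) (t : ℝ) : picardMajorant φ K B n t ≤ B := by
  cases n with
  | zero => exact le_rfl
  | succ n => exact min_le_left _ _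

include hφ

lemma continuous_picardMajorant (n : ℕ) : Continuous (picardMajorant φ K B n) := by
  induction n with
  | zero => exact continuous_const
  | succ n ih =>
    exact continuous_const.min <| continuous_const.mul <| intervalIntegral.continuous_primitive
      (fun a b => (hφ.continuous.comp ih).intervalIntegrable a b) 0

lemma intervalIntegrable_picardMajorant (n : ℕ) (a b : ℝ) :
    IntervalIntegrable (fun s => φ (picardMajorant φ K B n s)) volume a b :=
  (hφ.continuous.comp (hφ.continuous_picardMajorant n)).intervalIntegrable a b

lemma picardMajorant_nonneg (hK : 0 ≤ K) (hB : 0 ≤ B) (n : ℕ) {t : ℝ} (ht : 0 ≤ t) :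
    0 ≤ picardMajorant φ K B n t := by
  induction n generalizing t with
  | zero => exact hB
  | succ n ih =>
    exact le_min hB <| mul_nonneg hK <| intervalIntegral.integral_nonneg ht fun s hs =>
      hφ.nonneg (ih hs.1)

lemma antitone_picardMajorant (hK : 0 ≤ K) {t : ℝ} (ht : 0 ≤ t) :
    Antitone fun n => picardMajorant φ K B n t := by
  refine antitone_nat_of_succ_le fun n => ?_
  induction n generalizing t with
  | zero => exact min_le_left _ _
  | succ n ih =>
    refine min_le_min_left _ (mul_le_mul_of_nonneg_left ?_ hK)
    exact intervalIntegral.integral_mono_on ht (hφ.intervalIntegrable_picardMajorant (n + 1) 0 t)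
      (hφ.intervalIntegrable_picardMajorant n 0 t) fun s hs => hφ.monotone (ih hs.1)

lemma monotoneOn_picardMajorant (hK : 0 ≤ K) (hB : 0 ≤ B) (n : ℕ) :
    MonotoneOn (picardMajorant φ K B n) (Ici 0) := by
  cases n with
  | zero => exact monotoneOn_const
  | succ n =>
    refine fun s hs t _ hst => min_le_min_left _ (mul_le_mul_of_nonneg_left ?_ hK)
    refine intervalIntegral.integral_mono_interval le_rfl hs hst ?_
      (hφ.intervalIntegrable_picardMajorant n 0 t)
    filter_upwards [ae_restrict_mem measurableSet_Ioc] with r hr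
    exact hφ.nonneg (hφ.picardMajorant_nonneg hK hB n hr.1.le)

lemma le_integral_of_tendsto_picardMajorant (hK : 0 ≤ K) (hB : 0 ≤ B) {v : ℝ → ℝ}
    (hv : ∀ t, 0 ≤ t → Tendsto (fun n => picardMajorant φ K B n t) atTop (𝓝 (v t)))
    {t : ℝ} (ht : 0 ≤ t) : v t ≤ K * ∫ s in (0 : ℝ)..t, φ (v s) := by
  have hlim : Tendsto (fun n => K * ∫ s in (0 : ℝ)..t, φ (picardMajorant φ K B n s)) atTop
      (𝓝 (K * ∫ s in (0 : ℝ)..t, φ (v s))) := by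
    refine Tendsto.const_mul _ (intervalIntegral.tendsto_integral_filter_of_dominated_convergence
      (fun _ => φ B) (.of_forall fun n =>
        (hφ.intervalIntegrable_picardMajorant n 0 t).def'.aestronglyMeasurable)
      (.of_forall fun n => .of_forall fun s hs => ?_) intervalIntegrable_const
      (.of_forall fun s hs => ?_))
    all_goals rw [uIoc_of_le ht] at hs
    · rw [Real.norm_of_nonneg (hφ.nonneg (hφ.picardMajorant_nonneg hK hB n hs.1.le))]
      exact hφ.monotone (picardMajorant_le n s)
    · exact (hφ.continuous.tendsto _).comp (hv s hs.1.le)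
  exact le_of_tendsto_of_tendsto' ((tendsto_add_atTop_iff_nat 1).2 (hv t ht)) hlim
    fun n => min_le_right _ _

theorem tendsto_picardMajorant_zero {a : ℝ} (ha : 0 < a)
    (hbot : Tendsto (osgoodPrimitive φ a) (𝓝[>] 0) atBot) (hK : 0 ≤ K) (hB : 0 ≤ B)
    {t : ℝ} (ht : 0 ≤ t) : Tendsto (fun n => picardMajorant φ K B n t) atTop (𝓝 0) := by
  let v : ℝ → ℝ := fun t => ⨅ n, picardMajorant φ K B n t
  have hbdd : ∀ s, 0 ≤ s → BddBelow (range fun n => picardMajorant φ K B n s) := by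
    rintro s hs
    exact ⟨0, forall_mem_range.2 fun n => hφ.picardMajorant_nonneg hK hB n hs⟩
  have hlim : ∀ s, 0 ≤ s → Tendsto (fun n => picardMajorant φ K B n s) atTop (𝓝 (v s)) :=
    fun s hs => tendsto_atTop_ciInf (hφ.antitone_picardMajorant hK hs) (hbdd s hs)
  have hv0 : ∀ s, 0 ≤ s → 0 ≤ v s := fun s hs =>
    le_ciInf fun n => hφ.picardMajorant_nonneg hK hB n hs
  have hvmono : MonotoneOn v (Icc 0 t) := fun s hs r hr hsr =>
    ciInf_mono (hbdd s hs.1) fun n => hφ.monotoneOn_picardMajorant hK hB n hs.1 hr.1 hsr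
  have hint : IntegrableOn (fun s => φ (v s)) (Icc 0 t) :=
    (hφ.monotone.comp_monotoneOn hvmono).integrableOn_isCompact isCompact_Icc
  -- Osgood's inequality is applied to the right-hand side, as `v` need not be continuous a priori.
  let G : ℝ → ℝ := fun t => K * ∫ s in (0 : ℝ)..t, φ (v s)
  have hvG : ∀ s, 0 ≤ s → v s ≤ G s := fun s hs =>
    hφ.le_integral_of_tendsto_picardMajorant hK hB hlim hs
  have hGc : ContinuousOn G (Icc 0 t) :=
    continuousOn_const.mul (continuousOn_integral_zero hint)
  have hGle : ∀ s ∈ Icc 0 t, G s ≤ K * ∫ r in (0 : ℝ)..s, φ (G r) := fun s hs => by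
    have hsub : uIcc 0 s ⊆ Icc 0 t := uIcc_of_le hs.1 ▸ Icc_subset_Icc_right hs.2
    refine mul_le_mul_of_nonneg_left (intervalIntegral.integral_mono_on hs.1
      (hint.mono_set hsub).intervalIntegrable
      (hφ.continuous.comp_continuousOn (hGc.mono hsub)).intervalIntegrable fun r hr => ?_) hK
    exact hφ.monotone (hvG r hr.1)
  have hG : G t = 0 := hφ.eq_zero_of_le_integral ha hbot hK hGc
    (fun s hs => (hv0 s hs.1).trans (hvG s hs.1)) hGle t (right_mem_Icc.2 ht)
  have hvt : v t = 0 := le_antisymm ((hvG t ht).trans_eq hG) (hv0 t ht)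
  exact hvt ▸ hlim t ht

end IsModulus

/-- The paths that are continuous on `[0, T]` and stay in `S` up to time `T`. -/
def continuousPaths {X : Type*} [TopologicalSpace X] (S : Set X) (T : ℝ) : Set (ℝ → X) :=
  {w | ContinuousOn w (Icc 0 T) ∧ MapsTo w (Icc 0 T) S}

lemma continuousPaths_mono {X : Type*} [TopologicalSpace X] {S S' : Set X} {T T' : ℝ} (hS : S ⊆ S')
    (hT : T' ≤ T) : continuousPaths S T ⊆ continuousPaths S' T' := fun _ hw =>
  ⟨hw.1.mono (Icc_subset_Icc_right hT), (hw.2.mono_left (Icc_subset_Icc_right hT)).mono_right hS⟩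

section Picard

variable {X : Type*} [MetricSpace X] {S : Set X} {φ : ℝ → ℝ} {K T : ℝ} {P : (ℝ → X) → ℝ → X}

lemma IsModulus.dist_le_picardMajorant_succ (hφ : IsModulus φ) (hK : 0 ≤ K)
    (hS : Bornology.IsBounded S) (hP : MapsTo P (continuousPaths S T) (continuousPaths S T))
    (hdist : ∀ w ∈ continuousPaths S T, ∀ w' ∈ continuousPaths S T, ∀ t ∈ Icc 0 T,
      dist (P w t) (P w' t) ≤ K * ∫ s in (0 : ℝ)..t, φ (dist (w s) (w' s)))
    {w w' : ℝ → X} (hw : w ∈ continuousPaths S T) (hw' : w' ∈ continuousPaths S T) {n : ℕ}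
    (h : ∀ t ∈ Icc 0 T, dist (w t) (w' t) ≤ picardMajorant φ K (Metric.diam S) n t) :
    ∀ t ∈ Icc 0 T, dist (P w t) (P w' t) ≤ picardMajorant φ K (Metric.diam S) (n + 1) t := by
  intro t ht
  have hsub : uIcc 0 t ⊆ Icc 0 T := uIcc_of_le ht.1 ▸ Icc_subset_Icc_right ht.2
  refine le_min (Metric.dist_le_diam_of_mem hS ((hP hw).2 ht) ((hP hw').2 ht)) <|
    (hdist w hw w' hw' t ht).trans <| mul_le_mul_of_nonneg_left
      (intervalIntegral.integral_mono_on ht.1 ?_ (hφ.intervalIntegrable_picardMajorant n 0 t)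
        fun s hs => hφ.monotone (h s ⟨hs.1, hs.2.trans ht.2⟩)) hK
  exact (hφ.continuous.comp_continuousOn (continuous_dist.comp_continuousOn
    ((hw.1.mono hsub).prodMk (hw'.1.mono hsub)))).intervalIntegrable

lemma IsModulus.dist_iterate_le_picardMajorant (hφ : IsModulus φ) (hK : 0 ≤ K)
    (hS : Bornology.IsBounded S) (hP : MapsTo P (continuousPaths S T) (continuousPaths S T))
    (hdist : ∀ w ∈ continuousPaths S T, ∀ w' ∈ continuousPaths S T, ∀ t ∈ Icc 0 T,
      dist (P w t) (P w' t) ≤ K * ∫ s in (0 : ℝ)..t, φ (dist (w s) (w' s)))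
    {w w' : ℝ → X} (hw : w ∈ continuousPaths S T) (hw' : w' ∈ continuousPaths S T) (n : ℕ) :
    ∀ t ∈ Icc 0 T, dist (P^[n] w t) (P^[n] w' t) ≤ picardMajorant φ K (Metric.diam S) n t := by
  induction n with
  | zero => exact fun _ ht => Metric.dist_le_diam_of_mem hS (hw.2 ht) (hw'.2 ht)
  | succ n ih =>
    rw [Function.iterate_succ_apply', Function.iterate_succ_apply']
    exact hφ.dist_le_picardMajorant_succ hK hS hP hdist (hP.iterate n hw) (hP.iterate n hw') ih

lemma exists_mem_continuousPaths_dist_le (hS : IsComplete S) (hne : S.Nonempty) {w : ℕ → ℝ → X}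
    (hw : ∀ n, w n ∈ continuousPaths S T) {u : ℕ → ℝ → ℝ} (hmono : ∀ n, MonotoneOn (u n) (Ici 0))
    (hu : ∀ t, 0 ≤ t → Tendsto (fun n => u n t) atTop (𝓝 0))
    (hle : ∀ n m, n ≤ m → ∀ t ∈ Icc 0 T, dist (w n t) (w m t) ≤ u n t) :
    ∃ z ∈ continuousPaths S T, ∀ n, ∀ t ∈ Icc 0 T, dist (w n t) (z t) ≤ u n t := by
  have : Nonempty X := hne.to_type.map (↑)
  have hcauchy : ∀ t ∈ Icc 0 T, CauchySeq fun n => w n t := fun t ht =>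
    cauchySeq_of_le_tendsto_0' _ (fun n m hnm => hle n m hnm t ht) (hu t ht.1)
  choose! z hzS hz using fun t ht =>
    cauchySeq_tendsto_of_isComplete hS (fun n => (hw n).2 ht) (hcauchy t ht)
  have hwz : ∀ n, ∀ t ∈ Icc 0 T, dist (w n t) (z t) ≤ u n t := fun n t ht =>
    le_of_tendsto (tendsto_const_nhds.dist (hz t ht))
      ((eventually_ge_atTop n).mono fun m hm => hle n m hm t ht)
  have hunif : TendstoUniformlyOn w z atTop (Icc 0 T) := by
    refine Metric.tendstoUniformlyOn_iff.2 fun e he => ?_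
    rcases lt_or_ge T 0 with hT | hT
    · simp [Icc_eq_empty hT.not_ge]
    filter_upwards [(hu T hT).eventually (gt_mem_nhds he)] with n hn t ht
    rw [dist_comm]
    exact ((hwz n t ht).trans (hmono n ht.1 hT ht.2)).trans_lt hn
  exact ⟨z, ⟨hunif.continuousOn (.of_forall fun n => (hw n).1), hzS⟩, hwz⟩

theorem IsModulus.exists_fixedPoint (hφ : IsModulus φ) {a : ℝ} (ha : 0 < a)
    (hbot : Tendsto (osgoodPrimitive φ a) (𝓝[>] 0) atBot) (hK : 0 ≤ K)
    (hS : IsComplete S) (hSb : Bornology.IsBounded S) (hne : S.Nonempty)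
    (hP : MapsTo P (continuousPaths S T) (continuousPaths S T))
    (hdist : ∀ w ∈ continuousPaths S T, ∀ w' ∈ continuousPaths S T, ∀ t ∈ Icc 0 T,
      dist (P w t) (P w' t) ≤ K * ∫ s in (0 : ℝ)..t, φ (dist (w s) (w' s))) :
    ∃ z ∈ continuousPaths S T, EqOn (P z) z (Icc 0 T) := by
  obtain ⟨x, hx⟩ := hne
  let w : ℕ → ℝ → X := fun n => P^[n] fun _ => x
  have hw0 : (fun _ => x) ∈ continuousPaths S T := ⟨continuousOn_const, fun _ _ => hx⟩
  have hw : ∀ n, w n ∈ continuousPaths S T := fun n => hP.iterate n hw0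
  have hu : ∀ t, 0 ≤ t →
      Tendsto (fun n => picardMajorant φ K (Metric.diam S) n t) atTop (𝓝 0) := fun t ht =>
    hφ.tendsto_picardMajorant_zero ha hbot hK Metric.diam_nonneg ht
  have hle : ∀ n m, n ≤ m → ∀ t ∈ Icc 0 T,
      dist (w n t) (w m t) ≤ picardMajorant φ K (Metric.diam S) n t := by
    intro n m hnm t ht
    obtain ⟨k, rfl⟩ := Nat.exists_eq_add_of_le hnm
    simp only [w, Function.iterate_add_apply]
    exact hφ.dist_iterate_le_picardMajorant hK hSb hP hdist hw0 (hP.iterate k hw0) n t ht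
  obtain ⟨z, hz, hwz⟩ := exists_mem_continuousPaths_dist_le hS ⟨x, hx⟩ hw
    (hφ.monotoneOn_picardMajorant hK Metric.diam_nonneg) hu hle
  have hlim : ∀ t ∈ Icc 0 T, Tendsto (fun n => w (n + 1) t) atTop (𝓝 (z t)) := fun t ht =>
    tendsto_iff_dist_tendsto_zero.2 <| (tendsto_add_atTop_iff_nat 1).2 <|
      squeeze_zero (fun _ => dist_nonneg) (fun n => hwz n t ht) (hu t ht.1)
  refine ⟨z, hz, fun t ht => tendsto_nhds_unique ?_ (hlim t ht)⟩
  refine tendsto_iff_dist_tendsto_zero.2 (squeeze_zero (fun _ => dist_nonneg) (fun n => ?_)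
    ((tendsto_add_atTop_iff_nat 1).2 (hu t ht.1)))
  simp only [w, Function.iterate_succ_apply']
  exact hφ.dist_le_picardMajorant_succ hK hSb hP hdist (hw n) hz (hwz n) t ht

end Picard

variable {d : ℕ} {Ω : Set (E d)} {p₀ p₁ : E d → ℝ}

/-! ### Erosions -/

lemma erosion_anti {ρ ρ' : ℝ} (h : ρ ≤ ρ') : erosion Ω ρ' ⊆ erosion Ω ρ := fun _ hx =>
  (Metric.closedBall_subset_closedBall h).trans hx

lemma erosion_subset {ρ : ℝ} (hρ : 0 ≤ ρ) : erosion Ω ρ ⊆ Ω := fun _ hx =>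
  hx (Metric.mem_closedBall_self hρ)

lemma erosion_subset_interior {ρ : ℝ} (hρ : 0 < ρ) : erosion Ω ρ ⊆ interior Ω := fun _ hx =>
  mem_interior_iff_mem_nhds.2 (Metric.nhds_basis_closedBall.mem_iff.2 ⟨ρ, hρ, hx⟩)

lemma exists_mem_erosion {x : E d} (hx : x ∈ interior Ω) : ∃ ρ > 0, x ∈ erosion Ω ρ :=
  Metric.nhds_basis_closedBall.mem_iff.1 (mem_interior_iff_mem_nhds.1 hx)

lemma two_mul_le_diam_of_mem_erosion (hd : 1 ≤ d) (hΩ : Bornology.IsBounded Ω) {x : E d} {ρ : ℝ}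
    (hρ : 0 ≤ ρ) (hx : x ∈ erosion Ω ρ) : 2 * ρ ≤ Metric.diam Ω := by
  have : Nonempty (Fin d) := ⟨⟨0, hd⟩⟩
  rw [← Metric.diam_closedBall_eq x hρ]
  exact Metric.diam_mono hx hΩ

lemma smul_add_smul_mem_erosion (hΩ : Convex ℝ Ω) {x y : E d} {a b ρ : ℝ} (hx : x ∈ erosion Ω ρ)
    (hy : y ∈ Ω) (ha : 0 < a) (hb : 0 ≤ b) (hab : a + b = 1) :
    a • x + b • y ∈ erosion Ω (a * ρ) := by
  intro q hq
  have hmem : x + a⁻¹ • (q - (a • x + b • y)) ∈ Ω := hx <| by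
    rw [Metric.mem_closedBall, dist_eq_norm, add_sub_cancel_left, norm_smul,
      Real.norm_of_nonneg (by positivity), inv_mul_le_iff₀ ha, ← dist_eq_norm]
    exact hq
  have hq_eq : a • (x + a⁻¹ • (q - (a • x + b • y))) + b • y = q := by
    rw [smul_add, smul_inv_smul₀ ha.ne']
    abel
  exact hq_eq ▸ hΩ hmem hy ha.le hb hab

lemma mem_erosion_of_lt_infDist_frontier {x : E d} (hx : x ∈ Ω) {γ : ℝ}
    (h : γ < Metric.infDist x (frontier Ω)) : x ∈ erosion Ω γ := by
  rcases eq_or_ne Ω univ with rfl | hne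
  · exact subset_univ _
  obtain ⟨y, hy, hxy⟩ := exists_mem_frontier_infDist_compl_eq_dist hx hne
  exact (Metric.closedBall_subset_ball
    (hxy ▸ h.trans_le (Metric.infDist_le_dist_of_mem hy))).trans Metric.ball_infDist_compl_subset

/-! ### The modulus of relative continuity -/

/-- The relative deviation of the two densities between the points `x` and `y`: `omega` is its
supremum over pairs of points of `Ω` at a given distance. -/
def deviation (p₀ p₁ : E d → ℝ) (x y : E d) : ℝ := max |p₀ x / p₀ y - 1| |p₁ x / p₁ y - 1|

/-- The function `u ↦ u + ω(u)`. Up to a factor it is the modulus of continuity of the velocity. -/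
def velocityModulus (Ω : Set (E d)) (p₀ p₁ : E d → ℝ) (u : ℝ) : ℝ := u + omega Ω p₀ p₁ u

/-- A bound, depending only on the diameter `D` of `Ω` and on `w = ω⁻¹(1)`, for the ratio of two
values of a density: two points of `Ω` are joined by `⌈2 D / w⌉` steps of length at most `w / 2`,
along each of which the densities at most double. -/
def densityRatio (D w : ℝ) : ℝ := 2 ^ ⌈2 * D / w⌉₊

lemma one_le_densityRatio (D w : ℝ) : 1 ≤ densityRatio D w := one_le_pow₀ one_le_two

lemma deviation_nonneg (x y : E d) : 0 ≤ deviation p₀ p₁ x y := le_max_of_le_left (abs_nonneg _)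

lemma omega_le {B η : ℝ} (hB : 0 ≤ B)
    (h : ∀ x ∈ Ω, ∀ y ∈ Ω, ‖x - y‖ ≤ η → deviation p₀ p₁ x y ≤ B) : omega Ω p₀ p₁ η ≤ B := by
  refine Real.sSup_le ?_ hB
  rintro _ ⟨x, hx, y, hy, hxy, rfl⟩
  exact h x hx y hy hxy

lemma omega_nonneg (η : ℝ) : 0 ≤ omega Ω p₀ p₁ η := by
  refine Real.sSup_nonneg ?_
  rintro _ ⟨x, -, y, -, -, rfl⟩
  exact deviation_nonneg x y

lemma omega_of_neg {η : ℝ} (hη : η < 0) : omega Ω p₀ p₁ η = 0 :=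
  le_antisymm (omega_le le_rfl fun _ _ _ _ hxy => absurd (norm_nonneg _) (hxy.trans_lt hη).not_ge)
    (omega_nonneg _)

lemma IsRegularDensity.pos {p : E d → ℝ} (hp : IsRegularDensity Ω p) {x : E d} (hx : x ∈ Ω) :
    0 < p x := by
  obtain ⟨c, hc, hcp⟩ := hp.bounded_below
  exact hc.trans_le (hcp x hx)

/-- The standing assumptions on the domain and the two densities, except that `Ω` may have empty
interior. -/
structure Admissible (Ω : Set (E d)) (p₀ p₁ : E d → ℝ) : Prop where
  compact : IsCompact Ω
  convex : Convex ℝ Ω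
  left : IsRegularDensity Ω p₀
  right : IsRegularDensity Ω p₁

lemma one_add_abs_mul_sub_one_le (a b : ℝ) : 1 + |a * b - 1| ≤ (1 + |a - 1|) * (1 + |b - 1|) :=
  calc 1 + |a * b - 1| = 1 + |(a - 1) + (b - 1) + (a - 1) * (b - 1)| := by ring_nf
    _ ≤ 1 + (|a - 1| + |b - 1| + |(a - 1) * (b - 1)|) := by gcongr; exact abs_add_three _ _ _
    _ = (1 + |a - 1|) * (1 + |b - 1|) := by rw [abs_mul]; ring

lemma one_add_deviation_le {x y z : E d} (hz₀ : p₀ z ≠ 0) (hz₁ : p₁ z ≠ 0) :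
    1 + deviation p₀ p₁ x y ≤ (1 + deviation p₀ p₁ x z) * (1 + deviation p₀ p₁ z y) := by
  simp only [deviation]
  rw [← div_mul_div_cancel₀ (a := p₀ x) hz₀, ← div_mul_div_cancel₀ (a := p₁ x) (c := p₁ y) hz₁,
    ← max_add_add_left]
  refine max_le ((one_add_abs_mul_sub_one_le _ _).trans ?_)
    ((one_add_abs_mul_sub_one_le _ _).trans ?_)
  · gcongr <;> exact le_max_left _ _
  · gcongr <;> exact le_max_right _ _

lemma exists_mem_norm_sub_le {F : Type*} [SeminormedAddCommGroup F] [NormedSpace ℝ F] {S : Set F}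
    (hS : Convex ℝ S) {x y : F} (hx : x ∈ S) (hy : y ∈ S) {u v : ℝ} (hu : 0 ≤ u) (hv : 0 ≤ v)
    (hxy : ‖x - y‖ ≤ u + v) : ∃ z ∈ S, ‖x - z‖ ≤ u ∧ ‖z - y‖ ≤ v := by
  rcases (add_nonneg hu hv).eq_or_lt with h0 | h0
  · exact ⟨x, hx, by simpa using hu, hxy.trans (by linarith)⟩
  refine ⟨AffineMap.lineMap x y (u / (u + v)), hS.lineMap_mem hx hy
    ⟨by positivity, (div_le_one h0).2 (by linarith)⟩, ?_, ?_⟩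
  · rw [← dist_eq_norm, dist_left_lineMap, Real.norm_of_nonneg (by positivity), dist_eq_norm]
    calc u / (u + v) * ‖x - y‖ ≤ u / (u + v) * (u + v) := by gcongr
      _ = u := div_mul_cancel₀ _ h0.ne'
  · rw [← dist_eq_norm, dist_lineMap_right, one_sub_div h0.ne', add_sub_cancel_left,
      Real.norm_of_nonneg (by positivity), dist_eq_norm]
    calc v / (u + v) * ‖x - y‖ ≤ v / (u + v) * (u + v) := by gcongr
      _ = v := div_mul_cancel₀ _ h0.ne'

namespace Admissible

variable (H : Admissible Ω p₀ p₁)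
include H

lemma deviation_self {x : E d} (hx : x ∈ Ω) : deviation p₀ p₁ x x = 0 := by
  simp [deviation, div_self (H.left.pos hx).ne', div_self (H.right.pos hx).ne']

lemma continuousOn_deviation :
    ContinuousOn (fun q : E d × E d => deviation p₀ p₁ q.1 q.2) (Ω ×ˢ Ω) := by
  have hdiv : ∀ {p : E d → ℝ}, IsRegularDensity Ω p →
      ContinuousOn (fun q : E d × E d => |p q.1 / p q.2 - 1|) (Ω ×ˢ Ω) := fun hp =>
    (((hp.continuousOn.comp continuousOn_fst fun _ hq => hq.1).div
      (hp.continuousOn.comp continuousOn_snd fun _ hq => hq.2)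
      fun _ hq => (hp.pos hq.2).ne').sub continuousOn_const).abs
  exact ContinuousOn.sup (hdiv H.left) (hdiv H.right)

lemma exists_deviation_le : ∃ B, 0 ≤ B ∧ ∀ x ∈ Ω, ∀ y ∈ Ω, deviation p₀ p₁ x y ≤ B := by
  obtain ⟨B, hB⟩ := (H.compact.prod H.compact).exists_bound_of_continuousOn H.continuousOn_deviation
  exact ⟨max B 0, le_max_right _ _, fun x hx y hy =>
    ((le_abs_self _).trans (hB (x, y) ⟨hx, hy⟩)).trans (le_max_left _ _)⟩

lemma deviation_le_omega {x y : E d} {η : ℝ} (hx : x ∈ Ω) (hy : y ∈ Ω) (hxy : ‖x - y‖ ≤ η) :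
    deviation p₀ p₁ x y ≤ omega Ω p₀ p₁ η := by
  obtain ⟨B, -, hB⟩ := H.exists_deviation_le
  refine le_csSup ⟨B, ?_⟩ ⟨x, hx, y, hy, hxy, rfl⟩
  rintro _ ⟨z, hz, z', hz', -, rfl⟩
  exact hB z hz z' hz'

lemma exists_omega_le : ∃ B, 0 ≤ B ∧ ∀ η, omega Ω p₀ p₁ η ≤ B := by
  obtain ⟨B, hB, hle⟩ := H.exists_deviation_le
  exact ⟨B, hB, fun η => omega_le hB fun x hx y hy _ => hle x hx y hy⟩

lemma exists_pos_omega_le {e : ℝ} (he : 0 < e) : ∃ η > 0, omega Ω p₀ p₁ η ≤ e := by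
  have hunif :=
    (H.compact.prod H.compact).uniformContinuousOn_of_continuous H.continuousOn_deviation
  obtain ⟨η, hη, hdev⟩ := Metric.uniformContinuousOn_iff_le.1 hunif e he
  refine ⟨η, hη, omega_le he.le fun x hx y hy hxy => ?_⟩
  have := hdev (x, y) ⟨hx, hy⟩ (y, y) ⟨hy, hy⟩
    (by simpa [Prod.dist_eq, dist_eq_norm, hη.le] using hxy)
  rw [H.deviation_self hy, Real.dist_eq, sub_zero] at this
  exact (le_abs_self _).trans this

lemma omega_mono : Monotone (omega Ω p₀ p₁) := fun _ _ h =>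
  omega_le (omega_nonneg _) fun _ hx _ hy hxy => H.deviation_le_omega hx hy (hxy.trans h)

lemma omega_zero : omega Ω p₀ p₁ 0 = 0 := by
  refine le_antisymm (omega_le le_rfl fun x hx y _ hxy => ?_) (omega_nonneg _)
  obtain rfl : x = y := sub_eq_zero.1 (norm_le_zero_iff.1 hxy)
  exact (H.deviation_self hx).le

lemma one_add_omega_add_le {u v : ℝ} (hu : 0 ≤ u) (hv : 0 ≤ v) :
    1 + omega Ω p₀ p₁ (u + v) ≤ (1 + omega Ω p₀ p₁ u) * (1 + omega Ω p₀ p₁ v) := by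
  have hωu : 0 ≤ omega Ω p₀ p₁ u := omega_nonneg u
  have hωv : 0 ≤ omega Ω p₀ p₁ v := omega_nonneg v
  suffices omega Ω p₀ p₁ (u + v) ≤ (1 + omega Ω p₀ p₁ u) * (1 + omega Ω p₀ p₁ v) - 1 by linarith
  refine omega_le (by nlinarith) fun x hx y hy hxy => ?_
  obtain ⟨z, hz, hxz, hzy⟩ := exists_mem_norm_sub_le H.convex hx hy hu hv hxy
  have hdev := one_add_deviation_le (x := x) (y := y) (H.left.pos hz).ne' (H.right.pos hz).ne'
  have hle : (1 + deviation p₀ p₁ x z) * (1 + deviation p₀ p₁ z y) ≤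
      (1 + omega Ω p₀ p₁ u) * (1 + omega Ω p₀ p₁ v) :=
    mul_le_mul (add_le_add_right (H.deviation_le_omega hx hz hxz) 1)
      (add_le_add_right (H.deviation_le_omega hz hy hzy) 1)
      (add_nonneg zero_le_one (deviation_nonneg z y)) (by positivity)
  linarith

lemma continuous_omega : Continuous (omega Ω p₀ p₁) := by
  obtain ⟨B, hB, hωB⟩ := H.exists_omega_le
  have hsub : ∀ u v, u ≤ v →
      omega Ω p₀ p₁ v - omega Ω p₀ p₁ u ≤ (1 + B) * omega Ω p₀ p₁ (v - u) := by
    intro u v huv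
    have hω : 0 ≤ omega Ω p₀ p₁ (v - u) := omega_nonneg _
    rcases lt_or_ge u 0 with hu | hu
    · rw [omega_of_neg hu]
      nlinarith [H.omega_mono (by linarith : v ≤ v - u)]
    · have hadd := H.one_add_omega_add_le hu (sub_nonneg.2 huv)
      rw [add_sub_cancel] at hadd
      nlinarith [hωB u]
  refine Metric.continuous_iff.2 fun u e he => ?_
  obtain ⟨η, hη, hωη⟩ := H.exists_pos_omega_le (e := e / (2 * (1 + B))) (by positivity)
  have hdist : ∀ s t, s ≤ t → t - s ≤ η → dist (omega Ω p₀ p₁ s) (omega Ω p₀ p₁ t) < e := by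
    intro s t hst hη
    rw [dist_comm, Real.dist_eq, abs_of_nonneg (sub_nonneg.2 (H.omega_mono hst))]
    calc omega Ω p₀ p₁ t - omega Ω p₀ p₁ s
        ≤ (1 + B) * omega Ω p₀ p₁ (t - s) := hsub s t hst
      _ ≤ (1 + B) * (e / (2 * (1 + B))) := by
          gcongr
          exact (H.omega_mono hη).trans hωη
      _ = e / 2 := by field_simp
      _ < e := half_lt_self he
  refine ⟨η, hη, fun v hv => ?_⟩
  rw [Real.dist_eq, abs_lt] at hv
  rcases le_total u v with huv | huv
  · exact dist_comm (omega Ω p₀ p₁ u) _ ▸ hdist u v huv (by linarith)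
  · exact hdist v u huv (by linarith)

lemma omega_le_one {η : ℝ} (hη : η < omegaInvOne Ω p₀ p₁) : omega Ω p₀ p₁ η ≤ 1 := by
  have hmem : (0 : ℝ) ∈ {η | η ∈ Icc 0 (Metric.diam Ω) ∧ omega Ω p₀ p₁ η ≤ 1} :=
    ⟨left_mem_Icc.2 Metric.diam_nonneg, H.omega_zero.trans_le zero_le_one⟩
  obtain ⟨η', hη', hle⟩ := exists_lt_of_lt_csSup ⟨0, hmem⟩ hη
  exact (H.omega_mono hle.le).trans hη'.2

lemma omegaInvOne_pos (hD : 0 < Metric.diam Ω) : 0 < omegaInvOne Ω p₀ p₁ := by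
  obtain ⟨η, hη, hωη⟩ := H.exists_pos_omega_le one_pos
  have hmin : 0 < min η (Metric.diam Ω) := lt_min hη hD
  exact hmin.trans_le <| le_csSup ⟨Metric.diam Ω, fun _ h => h.1.2⟩
    ⟨⟨hmin.le, min_le_right _ _⟩, (H.omega_mono (min_le_left _ _)).trans hωη⟩

lemma one_add_omega_nat_mul_le {u : ℝ} (hu : 0 ≤ u) (k : ℕ) :
    1 + omega Ω p₀ p₁ (k * u) ≤ (1 + omega Ω p₀ p₁ u) ^ k := by
  induction k with
  | zero => simp [H.omega_zero]
  | succ k ih =>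
    have hω : 0 ≤ omega Ω p₀ p₁ u := omega_nonneg u
    rw [Nat.cast_succ, add_one_mul, pow_succ]
    exact (H.one_add_omega_add_le (by positivity) hu).trans (by gcongr)

lemma one_add_omega_diam_le :
    1 + omega Ω p₀ p₁ (Metric.diam Ω) ≤
      densityRatio (Metric.diam Ω) (omegaInvOne Ω p₀ p₁) := by
  rcases (Metric.diam_nonneg (s := Ω)).eq_or_lt with hD | hD
  · rw [← hD, H.omega_zero, add_zero]
    exact one_le_densityRatio _ _
  have hw := H.omegaInvOne_pos hD
  have hsteps : Metric.diam Ω ≤ ⌈2 * Metric.diam Ω / omegaInvOne Ω p₀ p₁⌉₊ *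
      (omegaInvOne Ω p₀ p₁ / 2) := by
    have := (div_le_iff₀ hw).1 (Nat.le_ceil (2 * Metric.diam Ω / omegaInvOne Ω p₀ p₁))
    linarith
  refine (add_le_add_right (H.omega_mono hsteps) 1).trans
    ((H.one_add_omega_nat_mul_le (half_pos hw).le _).trans ?_)
  have hω : 0 ≤ omega Ω p₀ p₁ (omegaInvOne Ω p₀ p₁ / 2) := omega_nonneg _
  exact pow_le_pow_left₀ (by positivity) (by linarith [H.omega_le_one (half_lt_self hw)]) _

lemma density_le {x y : E d} (hx : x ∈ Ω) (hy : y ∈ Ω) :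
    p₀ x ≤ densityRatio (Metric.diam Ω) (omegaInvOne Ω p₀ p₁) * p₀ y ∧
      p₁ x ≤ densityRatio (Metric.diam Ω) (omegaInvOne Ω p₀ p₁) * p₁ y := by
  have hdev : deviation p₀ p₁ x y ≤ omega Ω p₀ p₁ (Metric.diam Ω) := H.deviation_le_omega hx hy <|
    dist_eq_norm x y ▸ Metric.dist_le_diam_of_mem H.compact.isBounded hx hy
  have hω := H.one_add_omega_diam_le
  constructor
  · rw [← div_le_iff₀ (H.left.pos hy)]
    linarith [(le_abs_self _).trans ((le_max_left _ _).trans hdev)]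
  · rw [← div_le_iff₀ (H.right.pos hy)]
    linarith [(le_abs_self _).trans ((le_max_right _ _).trans hdev)]

lemma isModulus_velocityModulus : IsModulus (velocityModulus Ω p₀ p₁) where
  continuous := continuous_id.add H.continuous_omega
  monotone := monotone_id.add H.omega_mono
  map_zero := by simp [velocityModulus, H.omega_zero]
  pos := fun s hs => add_pos_of_pos_of_nonneg hs (omega_nonneg s)

end Admissible

/-! ### The inverse of `Ψ` -/

namespace Admissible

variable (H : Admissible Ω p₀ p₁) {a : ℝ}
include H

lemma strictMonoOn_Psi (ha : 0 < a) : StrictMonoOn (Psi Ω p₀ p₁ a) (Ioi 0) :=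
  H.isModulus_velocityModulus.strictMonoOn_osgoodPrimitive ha

lemma tendsto_Psi_atTop (ha : 0 < a) : Tendsto (Psi Ω p₀ p₁ a) atTop atTop := by
  obtain ⟨B, hB, hωB⟩ := H.exists_omega_le
  refine H.isModulus_velocityModulus.tendsto_osgoodPrimitive_atTop (L := 1 + B) ha one_pos
    fun s hs => ?_
  have hs : 1 ≤ s := hs
  have := hωB s
  unfold velocityModulus
  nlinarith

lemma surjOn_Psi (ha : 0 < a) (hΨ : Tendsto (Psi Ω p₀ p₁ a) (𝓝[>] 0) atBot) :
    SurjOn (Psi Ω p₀ p₁ a) (Ioi 0) univ :=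
  H.isModulus_velocityModulus.surjOn_osgoodPrimitive ha hΨ (H.tendsto_Psi_atTop ha)

lemma PsiInv_pos (ha : 0 < a) (hΨ : Tendsto (Psi Ω p₀ p₁ a) (𝓝[>] 0) atBot) (y : ℝ) :
    0 < PsiInv Ω p₀ p₁ a y :=
  Function.invFunOn_mem (H.surjOn_Psi ha hΨ (mem_univ y))

lemma Psi_PsiInv (ha : 0 < a) (hΨ : Tendsto (Psi Ω p₀ p₁ a) (𝓝[>] 0) atBot) (y : ℝ) :
    Psi Ω p₀ p₁ a (PsiInv Ω p₀ p₁ a y) = y :=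
  Function.invFunOn_eq (H.surjOn_Psi ha hΨ (mem_univ y))

lemma lt_PsiInv_iff (ha : 0 < a) (hΨ : Tendsto (Psi Ω p₀ p₁ a) (𝓝[>] 0) atBot) {u y : ℝ}
    (hu : 0 < u) : u < PsiInv Ω p₀ p₁ a y ↔ Psi Ω p₀ p₁ a u < y := by
  rw [← (H.strictMonoOn_Psi ha).lt_iff_lt hu (H.PsiInv_pos ha hΨ y), H.Psi_PsiInv ha hΨ]

end Admissible

/-! ### The sets of displacements -/

lemma isClosed_displacements (hΩ : IsClosed Ω) (t : ℝ) (z : E d) :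
    IsClosed (displacements Ω t z) :=
  (hΩ.preimage (by fun_prop : Continuous fun δ : E d => z - t • δ)).inter
    (hΩ.preimage (by fun_prop : Continuous fun δ : E d => z + (1 - t) • δ))

lemma convex_displacements (hΩ : Convex ℝ Ω) (t : ℝ) (z : E d) :
    Convex ℝ (displacements Ω t z) := by
  simp only [displacements, sub_eq_add_neg z, ← neg_smul]
  exact ((hΩ.translate_preimage_right z).smul_preimage (-t)).inter
    ((hΩ.translate_preimage_right z).smul_preimage (1 - t))

lemma norm_le_diam_of_mem_displacements (hΩ : Bornology.IsBounded Ω) {t : ℝ} {z δ : E d}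
    (hδ : δ ∈ displacements Ω t z) : ‖δ‖ ≤ Metric.diam Ω := by
  have h := Metric.dist_le_diam_of_mem hΩ hδ.2 hδ.1
  rwa [dist_eq_norm, show z + (1 - t) • δ - (z - t • δ) = δ by module] at h

lemma isCompact_displacements (hΩ : IsCompact Ω) (t : ℝ) (z : E d) :
    IsCompact (displacements Ω t z) :=
  Metric.isCompact_of_isClosed_isBounded (isClosed_displacements hΩ.isClosed t z) <|
    isBounded_iff_forall_norm_le.2
      ⟨Metric.diam Ω, fun _ => norm_le_diam_of_mem_displacements hΩ.isBounded⟩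

lemma zero_mem_displacements {t : ℝ} {z : E d} (hz : z ∈ Ω) : 0 ∈ displacements Ω t z := by
  simpa [displacements] using hz

lemma closedBall_subset_displacements {t ρ : ℝ} {z : E d} (ht : t ∈ Icc (0 : ℝ) 1)
    (hz : z ∈ erosion Ω ρ) : Metric.closedBall 0 ρ ⊆ displacements Ω t z := by
  intro δ hδ
  rw [mem_closedBall_zero_iff] at hδ
  constructor <;> apply hz
  · rw [Metric.mem_closedBall, dist_eq_norm, sub_sub_cancel_left, norm_neg, norm_smul,
      Real.norm_of_nonneg ht.1]
    exact (mul_le_of_le_one_left (norm_nonneg δ) ht.2).trans hδ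
  · rw [Metric.mem_closedBall, dist_eq_norm, add_sub_cancel_left, norm_smul,
      Real.norm_of_nonneg (sub_nonneg.2 ht.2)]
    exact (mul_le_of_le_one_left (norm_nonneg δ) (sub_le_self 1 ht.1)).trans hδ

lemma volume_displacements_pos {t : ℝ} {z : E d} (hΩ : IsCompact Ω) (ht : t ∈ Icc (0 : ℝ) 1)
    (hz : z ∈ interior Ω) : 0 < volume.real (displacements Ω t z) := by
  obtain ⟨ρ, hρ, hzρ⟩ := exists_mem_erosion hz
  refine ENNReal.toReal_pos (ne_of_gt ?_) (isCompact_displacements hΩ t z).measure_ne_top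
  exact (Metric.measure_closedBall_pos volume (0 : E d) hρ).trans_le
    (measure_mono (closedBall_subset_displacements ht hzρ))

open scoped Pointwise in
/- If `z` is the centre of a ball of radius `ρ` in `Ω`, then `z + y / c` is a convex combination
of `z' + y` and the point `z + (z - z') / (c - 1)` of this ball. -/
lemma displacements_subset_smul {t ρ c : ℝ} {z z' : E d} (hΩ : Convex ℝ Ω) (hc : 1 < c)
    (hz : z ∈ erosion Ω ρ) (hzz' : ‖z - z'‖ ≤ (c - 1) * ρ) :
    displacements Ω t z' ⊆ c • displacements Ω t z := by
  have hc₁ : 0 < c - 1 := sub_pos.2 hc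
  have hball : z + (c - 1)⁻¹ • (z - z') ∈ Ω := hz <| by
    rwa [Metric.mem_closedBall, dist_eq_norm, add_sub_cancel_left, norm_smul,
      Real.norm_of_nonneg (inv_nonneg.2 hc₁.le), inv_mul_le_iff₀ hc₁]
  have hshrink : ∀ y, z' + y ∈ Ω → z + c⁻¹ • y ∈ Ω := by
    intro y hy
    convert hΩ hy hball (a := c⁻¹) (b := 1 - c⁻¹) (by positivity)
      (sub_nonneg.2 (inv_le_one_of_one_le₀ hc.le)) (by ring) using 1
    have hcoef : (1 - c⁻¹) * (c - 1)⁻¹ = c⁻¹ := by field_simp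
    rw [smul_add, smul_add, smul_smul, hcoef]
    module
  intro δ hδ
  rw [mem_smul_set_iff_inv_smul_mem₀ (by positivity)]
  constructor
  · simpa only [smul_neg, ← sub_eq_add_neg, smul_comm c⁻¹ t] using
      hshrink (-(t • δ)) (by simpa only [sub_eq_add_neg] using hδ.1)
  · simpa only [smul_comm c⁻¹] using hshrink ((1 - t) • δ) hδ.2

open scoped Pointwise in
lemma volume_displacements_diff_le {t ρ c : ℝ} {z z' : E d} (hΩ : IsCompact Ω)
    (hconv : Convex ℝ Ω) (hc : 1 < c) (hzΩ : z ∈ Ω) (hz : z ∈ erosion Ω ρ)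
    (hzz' : ‖z - z'‖ ≤ (c - 1) * ρ) :
    volume.real (displacements Ω t z' \ displacements Ω t z) ≤
      (c ^ d - 1) * volume.real (displacements Ω t z) := by
  set S := displacements Ω t z
  have hS : IsCompact S := isCompact_displacements hΩ t z
  have hSc : S ⊆ c • S := fun δ hδ => by
    rw [mem_smul_set_iff_inv_smul_mem₀ (by positivity)]
    exact (convex_displacements hconv t z).smul_mem_of_zero_mem (zero_mem_displacements hzΩ) hδ
      ⟨by positivity, inv_le_one_of_one_le₀ hc.le⟩
  have hvol : volume.real (c • S) = c ^ d * volume.real S := by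
    rw [measureReal_def, Measure.addHaar_smul, ENNReal.toReal_mul, ENNReal.toReal_ofReal
      (abs_nonneg _), abs_of_nonneg (by positivity), finrank_euclideanSpace_fin, measureReal_def]
  calc volume.real (displacements Ω t z' \ S)
      ≤ volume.real (c • S \ S) :=
        measureReal_mono (sdiff_subset_sdiff_left (displacements_subset_smul hconv hc hz hzz'))
          ((measure_mono sdiff_subset).trans_lt (hS.smul c).measure_lt_top).ne
    _ = (c ^ d - 1) * volume.real S := by
      rw [measureReal_sdiff hSc hS.measurableSet (hS.smul c).measure_lt_top.ne, hvol]
      ring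

lemma one_add_pow_sub_one_le {x : ℝ} (hx₀ : 0 ≤ x) (hx₁ : x ≤ 1) (n : ℕ) :
    (1 + x) ^ n - 1 ≤ 2 ^ n * x := by
  induction n with
  | zero => simpa using hx₀
  | succ n ih =>
    have : (1 + x) ^ n ≤ 2 ^ n := pow_le_pow_left₀ (by positivity) (by linarith) n
    rw [pow_succ, pow_succ]
    nlinarith

open scoped symmDiff in
lemma volume_symmDiff_displacements_le {t ρ : ℝ} {z z' : E d} (hΩ : IsCompact Ω)
    (hconv : Convex ℝ Ω) (hρ : 0 < ρ) (hz : z ∈ erosion Ω ρ) (hz' : z' ∈ erosion Ω ρ)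
    (hzz' : ‖z - z'‖ ≤ ρ) :
    volume.real (displacements Ω t z ∆ displacements Ω t z') ≤
      2 * 4 ^ d * (‖z - z'‖ / ρ) * volume.real (displacements Ω t z) := by
  rcases eq_or_ne z z' with rfl | hne
  · simp
  set S := displacements Ω t z
  set S' := displacements Ω t z'
  set x := ‖z - z'‖ / ρ
  have hx : 0 < x := div_pos (norm_pos_iff.2 (sub_ne_zero.2 hne)) hρ
  have hx₁ : x ≤ 1 := (div_le_one hρ).2 hzz'
  have hxρ : (1 + x - 1) * ρ = ‖z - z'‖ := by rw [add_sub_cancel_left, div_mul_cancel₀ _ hρ.ne']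
  have hpow := one_add_pow_sub_one_le hx.le hx₁ d
  have hpow₁ : 1 ≤ (1 + x) ^ d := one_le_pow₀ (by linarith)
  have hpow₂ : (1 + x) ^ d ≤ 2 ^ d := pow_le_pow_left₀ (by positivity) (by linarith) d
  have hS'S : volume.real (S' \ S) ≤ ((1 + x) ^ d - 1) * volume.real S :=
    volume_displacements_diff_le hΩ hconv (by linarith) (erosion_subset hρ.le hz) hz hxρ.ge
  have hSS' : volume.real (S \ S') ≤ ((1 + x) ^ d - 1) * volume.real S' :=
    volume_displacements_diff_le hΩ hconv (by linarith) (erosion_subset hρ.le hz') hz'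
      (by rw [hxρ, norm_sub_rev])
  have hS' : volume.real S' ≤ 2 ^ d * volume.real S := by
    have := le_measureReal_sdiff (μ := volume) (s₁ := S') (s₂ := S)
      (isCompact_displacements hΩ t z).measure_ne_top
    nlinarith [measureReal_nonneg (μ := volume) (s := S)]
  calc volume.real (S ∆ S') ≤ volume.real (S \ S') + volume.real (S' \ S) :=
        measureReal_union_le _ _
    _ ≤ 2 ^ d * x * (2 ^ d * volume.real S) + 2 ^ d * x * volume.real S :=
        add_le_add (hSS'.trans (by gcongr)) (hS'S.trans (by gcongr))
    _ ≤ 2 ^ d * x * (2 ^ d * volume.real S) + 2 ^ d * x * (2 ^ d * volume.real S) := by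
        gcongr
        exact le_mul_of_one_le_left measureReal_nonneg (hpow₁.trans hpow₂)
    _ = 2 * 4 ^ d * x * volume.real S := by
        rw [show (4 : ℝ) = 2 * 2 by norm_num, mul_pow]
        ring

/-! ### Weighted means -/

section WeightedMean

variable {α F : Type*} [MeasurableSpace α] {μ : Measure α} [NormedAddCommGroup F] [NormedSpace ℝ F]

lemma weighted_mean_mem [CompleteSpace F] {K : Set F} (hK : IsClosed K) (hconv : Convex ℝ K)
    {f : α → ℝ} {g : α → F} (hf : Integrable f μ) (hfg : Integrable (fun x => f x • g x) μ)
    (hf₀ : ∀ᵐ x ∂μ, 0 ≤ f x) (hg : ∀ᵐ x ∂μ, f x ≠ 0 → g x ∈ K) (hpos : 0 < ∫ x, f x ∂μ) :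
    (∫ x, f x ∂μ)⁻¹ • ∫ x, f x • g x ∂μ ∈ K := by
  by_contra hmean
  obtain ⟨l, u, hu, hl⟩ := geometric_hahn_banach_point_closed hconv hK hmean
  rw [map_smul, ← l.integral_comp_comm hfg, smul_eq_mul, inv_mul_lt_iff₀ hpos, mul_comm,
    ← integral_const_mul] at hu
  refine hu.not_ge (integral_mono_ae (hf.const_mul u) (l.integrable_comp hfg) ?_)
  filter_upwards [hf₀, hg] with x hfx hgx
  rw [map_smul, smul_eq_mul, mul_comm]
  rcases eq_or_ne (f x) 0 with h | h
  · rw [h, zero_mul, zero_mul]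
  · exact mul_le_mul_of_nonneg_left (hl _ (hgx h)).le hfx

lemma norm_weighted_mean_sub_le {f f' : α → ℝ} {g : α → F} {m m' : F} {D : ℝ}
    (hf : Integrable f μ) (hf' : Integrable f' μ) (hfg : Integrable (fun x => f x • g x) μ)
    (hfg' : Integrable (fun x => f' x • g x) μ) (hf₀ : 0 ≤ ∫ x, f x ∂μ)
    (hm : (∫ x, f x ∂μ) • m = ∫ x, f x • g x ∂μ) (hm' : (∫ x, f' x ∂μ) • m' = ∫ x, f' x • g x ∂μ)
    (hg : ∀ᵐ x ∂μ, f x ≠ f' x → ‖g x‖ ≤ D) (hm'D : ‖m'‖ ≤ D) :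
    (∫ x, f x ∂μ) * ‖m - m'‖ ≤ 2 * D * ∫ x, |f x - f' x| ∂μ := by
  have hsplit : (∫ x, f x ∂μ) • (m - m') =
      (∫ x, (f x - f' x) • g x ∂μ) - (∫ x, (f x - f' x) ∂μ) • m' := by
    simp only [sub_smul]
    rw [integral_sub hfg hfg', integral_sub hf hf', ← hm, ← hm']
    module
  have hmean : ‖∫ x, (f x - f' x) • g x ∂μ‖ ≤ D * ∫ x, |f x - f' x| ∂μ := by
    rw [← integral_const_mul]
    refine norm_integral_le_of_norm_le ((hf.sub hf').abs.const_mul D) (hg.mono fun x hx => ?_)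
    rw [norm_smul, Real.norm_eq_abs, mul_comm]
    rcases eq_or_ne (f x) (f' x) with h | h
    · simp [h]
    · exact mul_le_mul_of_nonneg_right (hx h) (abs_nonneg _)
  calc (∫ x, f x ∂μ) * ‖m - m'‖ = ‖(∫ x, f x ∂μ) • (m - m')‖ := by
        rw [norm_smul, Real.norm_of_nonneg hf₀]
    _ ≤ ‖∫ x, (f x - f' x) • g x ∂μ‖ + |∫ x, (f x - f' x) ∂μ| * ‖m'‖ := by
        rw [hsplit, ← Real.norm_eq_abs, ← norm_smul]
        exact norm_sub_le _ _
    _ ≤ D * ∫ x, |f x - f' x| ∂μ + (∫ x, |f x - f' x| ∂μ) * D := by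
        gcongr
        exact abs_integral_le_integral_abs
    _ = 2 * D * ∫ x, |f x - f' x| ∂μ := by ring

end WeightedMean

/-! ### The conditional density of the displacement -/

/-- The unnormalized conditional density of `X₁ - X₀` given `X_t = z`, extended by zero. -/
def weight (Ω : Set (E d)) (p₀ p₁ : E d → ℝ) (t : ℝ) (z : E d) : E d → ℝ :=
  (displacements Ω t z).indicator fun δ => p₀ (z - t • δ) * p₁ (z + (1 - t) • δ)

lemma weight_of_mem {t : ℝ} {z δ : E d} (h : δ ∈ displacements Ω t z) :
    weight Ω p₀ p₁ t z δ = p₀ (z - t • δ) * p₁ (z + (1 - t) • δ) := indicator_of_mem h _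

lemma weight_of_notMem {t : ℝ} {z δ : E d} (h : δ ∉ displacements Ω t z) :
    weight Ω p₀ p₁ t z δ = 0 := indicator_of_notMem h _

lemma mem_displacements_of_weight_ne_zero {t : ℝ} {z δ : E d} (h : weight Ω p₀ p₁ t z δ ≠ 0) :
    δ ∈ displacements Ω t z := not_imp_comm.1 weight_of_notMem h

lemma weight_smul {F : Type*} [AddCommMonoid F] [Module ℝ F] (t : ℝ) (z : E d) (g : E d → F) :
    (fun δ => weight Ω p₀ p₁ t z δ • g δ) = (displacements Ω t z).indicator
      fun δ => (p₀ (z - t • δ) * p₁ (z + (1 - t) • δ)) • g δ :=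
  funext fun δ => (indicator_smul_apply_left _ _ _ δ).symm

lemma velocity_eq (hΩ : IsCompact Ω) (t : ℝ) (z : E d) : velocity Ω p₀ p₁ t z =
    (∫ δ, weight Ω p₀ p₁ t z δ)⁻¹ • ∫ δ, weight Ω p₀ p₁ t z δ • δ := by
  have hS := (isCompact_displacements hΩ t z).measurableSet
  rw [weight_smul, weight, integral_indicator hS, integral_indicator hS, velocity]

namespace Admissible

variable (H : Admissible Ω p₀ p₁)
include H

lemma weight_pos {t : ℝ} {z δ : E d} (h : δ ∈ displacements Ω t z) :
    0 < weight Ω p₀ p₁ t z δ :=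
  (mul_pos (H.left.pos h.1) (H.right.pos h.2)).trans_eq (weight_of_mem h).symm

lemma weight_nonneg (t : ℝ) (z δ : E d) : 0 ≤ weight Ω p₀ p₁ t z δ :=
  indicator_nonneg (fun _ h => (mul_pos (H.left.pos h.1) (H.right.pos h.2)).le) δ

lemma integrable_weight_smul {F : Type*} [NormedAddCommGroup F] [NormedSpace ℝ F] {g : E d → F}
    (hg : Continuous g) (t : ℝ) (z : E d) : Integrable fun δ => weight Ω p₀ p₁ t z δ • g δ := by
  have hS := isCompact_displacements H.compact t z
  have hp₀ : ContinuousOn (fun δ => p₀ (z - t • δ)) (displacements Ω t z) :=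
    H.left.continuousOn.comp (by fun_prop) fun _ h => h.1
  have hp₁ : ContinuousOn (fun δ => p₁ (z + (1 - t) • δ)) (displacements Ω t z) :=
    H.right.continuousOn.comp (by fun_prop) fun _ h => h.2
  rw [weight_smul, integrable_indicator_iff hS.measurableSet]
  exact ((hp₀.mul hp₁).smul hg.continuousOn).integrableOn_compact hS

lemma integrable_weight (t : ℝ) (z : E d) : Integrable (weight Ω p₀ p₁ t z) := by
  simpa using H.integrable_weight_smul (g := fun _ => (1 : ℝ)) continuous_const t z

lemma integral_weight_pos {t : ℝ} {z : E d} (ht : t ∈ Icc (0 : ℝ) 1) (hz : z ∈ interior Ω) :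
    0 < ∫ δ, weight Ω p₀ p₁ t z δ := by
  rw [integral_pos_iff_support_of_nonneg (fun δ => H.weight_nonneg t z δ) (H.integrable_weight t z)]
  exact (ENNReal.toReal_pos_iff.1 (volume_displacements_pos H.compact ht hz)).1.trans_le
    (measure_mono fun δ hδ => (H.weight_pos hδ).ne')

lemma integral_weight_smul_velocity {t : ℝ} {z : E d} (ht : t ∈ Icc (0 : ℝ) 1)
    (hz : z ∈ interior Ω) :
    (∫ δ, weight Ω p₀ p₁ t z δ) • velocity Ω p₀ p₁ t z = ∫ δ, weight Ω p₀ p₁ t z δ • δ := by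
  rw [velocity_eq H.compact, smul_inv_smul₀ (H.integral_weight_pos ht hz).ne']

lemma velocity_mem_displacements {t : ℝ} {z : E d} (ht : t ∈ Icc (0 : ℝ) 1)
    (hz : z ∈ interior Ω) : velocity Ω p₀ p₁ t z ∈ displacements Ω t z := by
  rw [velocity_eq H.compact]
  exact weighted_mean_mem (isClosed_displacements H.compact.isClosed t z)
    (convex_displacements H.convex t z) (H.integrable_weight t z)
    (H.integrable_weight_smul continuous_id t z) (ae_of_all _ (H.weight_nonneg t z))
    (ae_of_all _ fun _ => mem_displacements_of_weight_ne_zero) (H.integral_weight_pos ht hz)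

lemma norm_velocity_le {t : ℝ} {z : E d} (ht : t ∈ Icc (0 : ℝ) 1) (hz : z ∈ interior Ω) :
    ‖velocity Ω p₀ p₁ t z‖ ≤ Metric.diam Ω :=
  norm_le_diam_of_mem_displacements H.compact.isBounded (H.velocity_mem_displacements ht hz)

/-! ### Comparison of the weights of two points -/

lemma weight_mul_volume_le (t t' : ℝ) (z z' δ : E d) :
    weight Ω p₀ p₁ t' z' δ * volume.real (displacements Ω t z) ≤
      densityRatio (Metric.diam Ω) (omegaInvOne Ω p₀ p₁) ^ 2 * ∫ δ, weight Ω p₀ p₁ t z δ := by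
  set R := densityRatio (Metric.diam Ω) (omegaInvOne Ω p₀ p₁)
  have hS := isCompact_displacements H.compact t z
  have hR : 0 ≤ R := zero_le_one.trans (one_le_densityRatio _ _)
  by_cases hδ : δ ∈ displacements Ω t' z'
  swap
  · rw [weight_of_notMem hδ, zero_mul]
    exact mul_nonneg (sq_nonneg R) (integral_nonneg (H.weight_nonneg t z))
  have hle : ∀ δ' ∈ displacements Ω t z,
      weight Ω p₀ p₁ t' z' δ ≤ R ^ 2 * weight Ω p₀ p₁ t z δ' := by
    intro δ' hδ'
    rw [weight_of_mem hδ, weight_of_mem hδ']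
    calc p₀ (z' - t' • δ) * p₁ (z' + (1 - t') • δ)
        ≤ (R * p₀ (z - t • δ')) * (R * p₁ (z + (1 - t) • δ')) :=
          mul_le_mul (H.density_le hδ.1 hδ'.1).1 (H.density_le hδ.2 hδ'.2).2
            (H.right.pos hδ.2).le (mul_nonneg hR (H.left.pos hδ'.1).le)
      _ = R ^ 2 * (p₀ (z - t • δ') * p₁ (z + (1 - t) • δ')) := by ring
  calc weight Ω p₀ p₁ t' z' δ * volume.real (displacements Ω t z)
      = ∫ _ in displacements Ω t z, weight Ω p₀ p₁ t' z' δ := by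
        rw [setIntegral_const, smul_eq_mul, mul_comm]
    _ ≤ ∫ δ' in displacements Ω t z, R ^ 2 * weight Ω p₀ p₁ t z δ' :=
        setIntegral_mono_on (integrableOn_const hS.measure_ne_top)
          ((H.integrable_weight t z).const_mul _).integrableOn hS.measurableSet hle
    _ ≤ ∫ δ', R ^ 2 * weight Ω p₀ p₁ t z δ' :=
        setIntegral_le_integral ((H.integrable_weight t z).const_mul _)
          (ae_of_all _ fun δ' => mul_nonneg (sq_nonneg R) (H.weight_nonneg t z δ'))
    _ = R ^ 2 * ∫ δ', weight Ω p₀ p₁ t z δ' := integral_const_mul _ _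

lemma abs_weight_sub_le {t : ℝ} {z z' δ : E d} (hω : omega Ω p₀ p₁ ‖z - z'‖ ≤ 1)
    (hδ : δ ∈ displacements Ω t z) (hδ' : δ ∈ displacements Ω t z') :
    |weight Ω p₀ p₁ t z δ - weight Ω p₀ p₁ t z' δ| ≤
      3 * omega Ω p₀ p₁ ‖z - z'‖ * weight Ω p₀ p₁ t z δ := by
  set ω := omega Ω p₀ p₁ ‖z - z'‖
  have hω₀ : 0 ≤ ω := omega_nonneg _
  have hW := H.weight_pos hδ
  have h₀ : |p₀ (z' - t • δ) / p₀ (z - t • δ) - 1| ≤ ω :=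
    (le_max_left _ _).trans (H.deviation_le_omega hδ'.1 hδ.1 (by simp [norm_sub_rev]))
  have h₁ : |p₁ (z' + (1 - t) • δ) / p₁ (z + (1 - t) • δ) - 1| ≤ ω :=
    (le_max_right _ _).trans (H.deviation_le_omega hδ'.2 hδ.2 (by simp [norm_sub_rev]))
  have hratio : |weight Ω p₀ p₁ t z' δ / weight Ω p₀ p₁ t z δ - 1| ≤ 3 * ω := by
    rw [weight_of_mem hδ, weight_of_mem hδ', ← div_mul_div_comm]
    have := one_add_abs_mul_sub_one_le (p₀ (z' - t • δ) / p₀ (z - t • δ))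
      (p₁ (z' + (1 - t) • δ) / p₁ (z + (1 - t) • δ))
    have : (1 + |p₀ (z' - t • δ) / p₀ (z - t • δ) - 1|) *
        (1 + |p₁ (z' + (1 - t) • δ) / p₁ (z + (1 - t) • δ) - 1|) ≤ (1 + ω) * (1 + ω) := by gcongr
    nlinarith
  rwa [div_sub_one hW.ne', abs_div, abs_of_pos hW, div_le_iff₀ hW, abs_sub_comm] at hratio

open scoped symmDiff in
lemma abs_weight_sub_le_add_indicator {t : ℝ} {z z' : E d} {M : ℝ}
    (hω : omega Ω p₀ p₁ ‖z - z'‖ ≤ 1) (hM : ∀ y δ, weight Ω p₀ p₁ t y δ ≤ M) (δ : E d) :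
    |weight Ω p₀ p₁ t z δ - weight Ω p₀ p₁ t z' δ| ≤
      3 * omega Ω p₀ p₁ ‖z - z'‖ * weight Ω p₀ p₁ t z δ +
        (displacements Ω t z ∆ displacements Ω t z').indicator (fun _ => M) δ := by
  have hω₀ : 0 ≤ omega Ω p₀ p₁ ‖z - z'‖ := omega_nonneg _
  by_cases hδ : δ ∈ displacements Ω t z <;> by_cases hδ' : δ ∈ displacements Ω t z'
  · rw [indicator_of_notMem fun h => h.elim (fun h => h.2 hδ') (fun h => h.2 hδ), add_zero]
    exact H.abs_weight_sub_le hω hδ hδ'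
  · have hW := H.weight_nonneg t z δ
    rw [indicator_of_mem (mem_symmDiff.2 (Or.inl ⟨hδ, hδ'⟩)), weight_of_notMem hδ', sub_zero,
      abs_of_nonneg hW]
    exact (hM z δ).trans (le_add_of_nonneg_left (by positivity))
  · rw [indicator_of_mem (mem_symmDiff.2 (Or.inr ⟨hδ', hδ⟩)), weight_of_notMem hδ, zero_sub,
      abs_neg, abs_of_nonneg (H.weight_nonneg t z' δ), mul_zero, zero_add]
    exact hM z' δ
  · rw [indicator_of_notMem fun h => h.elim (fun h => hδ h.1) (fun h => hδ' h.1),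
      weight_of_notMem hδ, weight_of_notMem hδ']
    simp

lemma integral_abs_weight_sub_le {t ρ : ℝ} {z z' : E d} (ht : t ∈ Icc (0 : ℝ) 1) (hρ : 0 < ρ)
    (hz : z ∈ erosion Ω ρ) (hz' : z' ∈ erosion Ω ρ) (hzz' : ‖z - z'‖ ≤ ρ)
    (hω : omega Ω p₀ p₁ ‖z - z'‖ ≤ 1) :
    ∫ δ, |weight Ω p₀ p₁ t z δ - weight Ω p₀ p₁ t z' δ| ≤
      (3 * omega Ω p₀ p₁ ‖z - z'‖ + 2 * 4 ^ d *
        densityRatio (Metric.diam Ω) (omegaInvOne Ω p₀ p₁) ^ 2 * (‖z - z'‖ / ρ)) *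
        ∫ δ, weight Ω p₀ p₁ t z δ := by
  set R := densityRatio (Metric.diam Ω) (omegaInvOne Ω p₀ p₁)
  set V := volume.real (displacements Ω t z)
  set N := symmDiff (displacements Ω t z) (displacements Ω t z')
  set I := ∫ δ, weight Ω p₀ p₁ t z δ
  have hzi := erosion_subset_interior hρ hz
  have hV : 0 < V := volume_displacements_pos H.compact ht hzi
  have hI : 0 < I := H.integral_weight_pos ht hzi
  have hS := isCompact_displacements H.compact t z
  have hS' := isCompact_displacements H.compact t z'
  have hM : ∀ y δ, weight Ω p₀ p₁ t y δ ≤ R ^ 2 * I / V := fun y δ =>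
    (le_div_iff₀ hV).2 (H.weight_mul_volume_le t t z y δ)
  have hN : MeasurableSet N := hS.measurableSet.symmDiff hS'.measurableSet
  have hint : Integrable fun δ => 3 * omega Ω p₀ p₁ ‖z - z'‖ * weight Ω p₀ p₁ t z δ :=
    (H.integrable_weight t z).const_mul _
  have hintN : Integrable (N.indicator fun _ => R ^ 2 * I / V) :=
    (integrable_indicator_iff hN).2 <| integrableOn_const <| measure_ne_top_of_subset
      symmDiff_le_sup (measure_union_ne_top hS.measure_ne_top hS'.measure_ne_top)
  calc ∫ δ, |weight Ω p₀ p₁ t z δ - weight Ω p₀ p₁ t z' δ|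
      ≤ ∫ δ, (3 * omega Ω p₀ p₁ ‖z - z'‖ * weight Ω p₀ p₁ t z δ +
          N.indicator (fun _ => R ^ 2 * I / V) δ) :=
        integral_mono ((H.integrable_weight t z).sub (H.integrable_weight t z')).abs
          (hint.add hintN) (H.abs_weight_sub_le_add_indicator hω hM)
    _ = 3 * omega Ω p₀ p₁ ‖z - z'‖ * I + volume.real N * (R ^ 2 * I / V) := by
        rw [integral_add hint hintN, integral_const_mul, integral_indicator hN, setIntegral_const,
          smul_eq_mul]
    _ ≤ 3 * omega Ω p₀ p₁ ‖z - z'‖ * I +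
          2 * 4 ^ d * (‖z - z'‖ / ρ) * V * (R ^ 2 * I / V) := by
        gcongr
        exact volume_symmDiff_displacements_le H.compact H.convex hρ hz hz' hzz'
    _ = (3 * omega Ω p₀ p₁ ‖z - z'‖ + 2 * 4 ^ d * R ^ 2 * (‖z - z'‖ / ρ)) * I := by
        field_simp

end Admissible

/-! ### The modulus of continuity of the velocity -/

/-- The constant in the modulus of continuity of the velocity, for a domain of diameter `D` with
`ω⁻¹(1) = w` in dimension `d`. -/
def velocityConst (d : ℕ) (D w : ℝ) : ℝ := 6 * |D| * (4 ^ d * densityRatio D w ^ 2) + 1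

lemma velocityConst_pos (d : ℕ) (D w : ℝ) : 0 < velocityConst d D w := by
  unfold velocityConst
  positivity

namespace Admissible

variable (H : Admissible Ω p₀ p₁)
include H

lemma norm_velocity_sub_le_of_close {t ρ : ℝ} {z z' : E d} (ht : t ∈ Icc (0 : ℝ) 1) (hρ : 0 < ρ)
    (hz : z ∈ erosion Ω ρ) (hz' : z' ∈ erosion Ω ρ) (hzz' : ‖z - z'‖ ≤ ρ)
    (hω : omega Ω p₀ p₁ ‖z - z'‖ ≤ 1) :
    ‖velocity Ω p₀ p₁ t z - velocity Ω p₀ p₁ t z'‖ ≤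
      2 * Metric.diam Ω * (3 * omega Ω p₀ p₁ ‖z - z'‖ + 2 * 4 ^ d *
        densityRatio (Metric.diam Ω) (omegaInvOne Ω p₀ p₁) ^ 2 * (‖z - z'‖ / ρ)) := by
  have hzi := erosion_subset_interior hρ hz
  have hzi' := erosion_subset_interior hρ hz'
  have hsupp : ∀ δ, weight Ω p₀ p₁ t z δ ≠ weight Ω p₀ p₁ t z' δ → ‖δ‖ ≤ Metric.diam Ω := by
    intro δ hδ
    by_contra hlt
    have hnot : ∀ y, δ ∉ displacements Ω t y := fun y hy =>
      hlt (norm_le_diam_of_mem_displacements H.compact.isBounded hy)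
    exact hδ ((weight_of_notMem (hnot z)).trans (weight_of_notMem (hnot z')).symm)
  have hI := H.integral_weight_pos ht hzi
  have hmean := norm_weighted_mean_sub_le (H.integrable_weight t z) (H.integrable_weight t z')
    (H.integrable_weight_smul continuous_id t z) (H.integrable_weight_smul continuous_id t z')
    hI.le (H.integral_weight_smul_velocity ht hzi) (H.integral_weight_smul_velocity ht hzi')
    (ae_of_all _ hsupp) (H.norm_velocity_le ht hzi')
  refine le_of_mul_le_mul_left (hmean.trans ?_) hI
  rw [mul_left_comm, mul_comm (∫ δ, weight Ω p₀ p₁ t z δ)]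
  exact mul_le_mul_of_nonneg_left (H.integral_abs_weight_sub_le ht hρ hz hz' hzz' hω)
    (mul_nonneg zero_le_two Metric.diam_nonneg)

lemma norm_velocity_sub_le {t ρ : ℝ} {z z' : E d} (ht : t ∈ Icc (0 : ℝ) 1) (hρ : 0 < ρ)
    (hz : z ∈ erosion Ω ρ) (hz' : z' ∈ erosion Ω ρ) :
    ‖velocity Ω p₀ p₁ t z - velocity Ω p₀ p₁ t z'‖ ≤
      velocityConst d (Metric.diam Ω) (omegaInvOne Ω p₀ p₁) * (1 + 1 / ρ) *
        velocityModulus Ω p₀ p₁ ‖z - z'‖ := by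
  set R := densityRatio (Metric.diam Ω) (omegaInvOne Ω p₀ p₁) with hR
  set u := ‖z - z'‖
  set q := omega Ω p₀ p₁ u
  set D := Metric.diam Ω
  have hu : 0 ≤ u := norm_nonneg _
  have hq : 0 ≤ q := omega_nonneg u
  have hD : 0 ≤ D := Metric.diam_nonneg
  have hX : 1 ≤ 4 ^ d * R ^ 2 := one_le_mul_of_one_le_of_one_le
    (one_le_pow₀ (by norm_num)) (one_le_pow₀ (one_le_densityRatio _ _))
  have hfactor : q + u / ρ ≤ (1 + 1 / ρ) * velocityModulus Ω p₀ p₁ u :=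
    calc q + u / ρ ≤ q + u / ρ + (u + q / ρ) := le_add_of_nonneg_right (by positivity)
      _ = (1 + 1 / ρ) * (u + q) := by ring
  suffices hmain : ‖velocity Ω p₀ p₁ t z - velocity Ω p₀ p₁ t z'‖ ≤
      6 * D * (4 ^ d * R ^ 2) * (q + u / ρ) by
    rw [mul_assoc, velocityConst, abs_of_nonneg hD, ← hR]
    exact hmain.trans (mul_le_mul (le_add_of_nonneg_right zero_le_one) hfactor (by positivity)
      (by positivity))
  by_cases hclose : u ≤ ρ ∧ q ≤ 1
  · calc ‖velocity Ω p₀ p₁ t z - velocity Ω p₀ p₁ t z'‖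
        ≤ 2 * D * (3 * q + 2 * 4 ^ d * R ^ 2 * (u / ρ)) :=
          H.norm_velocity_sub_le_of_close ht hρ hz hz' hclose.1 hclose.2
      _ ≤ 2 * D * (3 * ((4 ^ d * R ^ 2) * q) + 3 * (4 ^ d * R ^ 2) * (u / ρ)) := by
          gcongr 2 * D * (3 * ?_ + ?_ * _)
          · exact le_mul_of_one_le_left hq hX
          · linarith
      _ = 6 * D * (4 ^ d * R ^ 2) * (q + u / ρ) := by ring
  · have hfar : 1 ≤ q + u / ρ := by
      rcases not_and_or.1 hclose with h | h
      · linarith [(one_lt_div hρ).2 (not_le.1 h)]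
      · linarith [not_le.1 h, div_nonneg hu hρ.le]
    calc ‖velocity Ω p₀ p₁ t z - velocity Ω p₀ p₁ t z'‖ ≤ D + D :=
          norm_sub_le_of_le (H.norm_velocity_le ht (erosion_subset_interior hρ hz))
            (H.norm_velocity_le ht (erosion_subset_interior hρ hz'))
      _ ≤ 6 * D * (1 * 1) := by linarith
      _ ≤ 6 * D * ((4 ^ d * R ^ 2) * (q + u / ρ)) := by gcongr
      _ = 6 * D * (4 ^ d * R ^ 2) * (q + u / ρ) := by ring

end Admissible

/-! ### Continuity of the velocity -/

lemma add_smul_mem_interior {z δ : E d} (hz : z ∈ interior Ω) (s : ℝ)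
    (hδ : δ ∈ interior ((fun δ : E d => z + s • δ) ⁻¹' Ω)) : z + s • δ ∈ interior Ω := by
  rcases eq_or_ne s 0 with rfl | hs
  · rwa [zero_smul, add_zero]
  · let h : E d ≃ₜ E d := (Homeomorph.smulOfNeZero s hs).trans (Homeomorph.addLeft z)
    exact (h.preimage_interior Ω).ge hδ

lemma mem_interior_of_mem_interior_displacements {t : ℝ} {z δ : E d} (hz : z ∈ interior Ω)
    (hδ : δ ∈ interior (displacements Ω t z)) :
    z - t • δ ∈ interior Ω ∧ z + (1 - t) • δ ∈ interior Ω := by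
  refine ⟨?_, add_smul_mem_interior hz _ (interior_mono (fun _ h => h.2) hδ)⟩
  rw [sub_eq_add_neg, ← neg_smul]
  refine add_smul_mem_interior hz _ (interior_mono (fun y hy => ?_) hδ)
  rw [mem_preimage, neg_smul, ← sub_eq_add_neg]
  exact hy.1

namespace Admissible

variable (H : Admissible Ω p₀ p₁)
include H

lemma continuousAt_weight {t : ℝ} {z δ : E d} (hz : z ∈ interior Ω)
    (hδ : δ ∉ frontier (displacements Ω t z)) :
    ContinuousAt (fun q : ℝ × E d => weight Ω p₀ p₁ q.1 q.2 δ) (t, z) := by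
  have h₀ : ContinuousAt (fun q : ℝ × E d => q.2 - q.1 • δ) (t, z) := by fun_prop
  have h₁ : ContinuousAt (fun q : ℝ × E d => q.2 + (1 - q.1) • δ) (t, z) := by fun_prop
  by_cases hmem : δ ∈ displacements Ω t z
  · obtain ⟨hi₀, hi₁⟩ := mem_interior_of_mem_interior_displacements hz
      (not_not.1 fun h => hδ ⟨subset_closure hmem, h⟩)
    have hp₀ := H.left.continuousOn.continuousAt (mem_interior_iff_mem_nhds.1 hi₀)
    have hp₁ := H.right.continuousOn.continuousAt (mem_interior_iff_mem_nhds.1 hi₁)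
    refine ((hp₀.comp_of_eq h₀ rfl).mul (hp₁.comp_of_eq h₁ rfl)).congr ?_
    filter_upwards [h₀ (isOpen_interior.mem_nhds hi₀), h₁ (isOpen_interior.mem_nhds hi₁)]
      with q hq₀ hq₁
    exact (weight_of_mem ⟨interior_subset hq₀, interior_subset hq₁⟩).symm
  · have hcl := H.compact.isClosed.isOpen_compl
    refine (continuousAt_const (y := (0 : ℝ))).congr ?_
    rcases not_and_or.1 hmem with h | h
    · filter_upwards [h₀ (hcl.mem_nhds h)] with q hq
      exact (weight_of_notMem fun hm => hq hm.1).symm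
    · filter_upwards [h₁ (hcl.mem_nhds h)] with q hq
      exact (weight_of_notMem fun hm => hq hm.2).symm

variable {F : Type*} [NormedAddCommGroup F] [NormedSpace ℝ F] {g : E d → F}

lemma exists_norm_weight_smul_le (hg : Continuous g) : ∃ M : ℝ, ∀ t z δ,
    ‖weight Ω p₀ p₁ t z δ • g δ‖ ≤
      (Metric.closedBall 0 (Metric.diam Ω)).indicator (fun _ => M) δ := by
  obtain ⟨M₀, h₀⟩ := H.compact.exists_bound_of_continuousOn H.left.continuousOn
  obtain ⟨M₁, h₁⟩ := H.compact.exists_bound_of_continuousOn H.right.continuousOn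
  obtain ⟨C, hC⟩ := (isCompact_closedBall (0 : E d) (Metric.diam Ω)).exists_bound_of_continuousOn
    hg.continuousOn
  refine ⟨|M₀| * |M₁| * |C|, fun t z δ => ?_⟩
  by_cases hδ : δ ∈ displacements Ω t z
  · have hball : δ ∈ Metric.closedBall (0 : E d) (Metric.diam Ω) :=
      mem_closedBall_zero_iff.2 (norm_le_diam_of_mem_displacements H.compact.isBounded hδ)
    rw [indicator_of_mem hball, weight_of_mem hδ, norm_smul, norm_mul]
    gcongr
    exacts [(h₀ _ hδ.1).trans (le_abs_self _), (h₁ _ hδ.2).trans (le_abs_self _),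
      (hC δ hball).trans (le_abs_self _)]
  · rw [weight_of_notMem hδ, zero_smul, norm_zero]
    exact indicator_nonneg (fun _ _ => by positivity) δ

lemma continuousAt_integral_weight_smul (hg : Continuous g) {t : ℝ} {z : E d}
    (hz : z ∈ interior Ω) :
    ContinuousAt (fun q : ℝ × E d => ∫ δ, weight Ω p₀ p₁ q.1 q.2 δ • g δ) (t, z) := by
  obtain ⟨M, hM⟩ := H.exists_norm_weight_smul_le hg
  have hball := isCompact_closedBall (0 : E d) (Metric.diam Ω)
  have hfrontier : ∀ᵐ δ : E d, δ ∉ frontier (displacements Ω t z) :=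
    measure_eq_zero_iff_ae_notMem.1 ((convex_displacements H.convex t z).addHaar_frontier volume)
  refine continuousAt_of_dominated
    (Eventually.of_forall fun q => (H.integrable_weight_smul hg q.1 q.2).aestronglyMeasurable)
    (Eventually.of_forall fun q => ae_of_all _ (hM q.1 q.2))
    ((integrable_indicator_iff hball.measurableSet).2 (integrableOn_const hball.measure_ne_top))
    (hfrontier.mono fun δ hδ => ?_)
  exact (H.continuousAt_weight hz hδ).smul continuousAt_const

lemma continuousAt_velocity {t : ℝ} {z : E d} (ht : t ∈ Icc (0 : ℝ) 1) (hz : z ∈ interior Ω) :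
    ContinuousAt (fun q : ℝ × E d => velocity Ω p₀ p₁ q.1 q.2) (t, z) := by
  have hmass : ContinuousAt (fun q : ℝ × E d => ∫ δ, weight Ω p₀ p₁ q.1 q.2 δ) (t, z) := by
    simpa only [smul_eq_mul, mul_one] using
      H.continuousAt_integral_weight_smul (g := fun _ => (1 : ℝ)) continuous_const hz
  have hmean := (hmass.inv₀ (H.integral_weight_pos ht hz).ne').smul
    (H.continuousAt_integral_weight_smul continuous_id hz)
  exact hmean.congr (Eventually.of_forall fun q => (velocity_eq H.compact q.1 q.2).symm)

end Admissible

/-! ### Rectified paths up to a time before `1` -/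

/-- The conditional mean of `X₁` given `X_t = z`. -/
def terminalMean (Ω : Set (E d)) (p₀ p₁ : E d → ℝ) (t : ℝ) (z : E d) : E d :=
  z + (1 - t) • velocity Ω p₀ p₁ t z

/-- The derivative of `w s / (1 - s)` along a rectified path `w`. -/
def rescaledVelocity (Ω : Set (E d)) (p₀ p₁ : E d → ℝ) (w : ℝ → E d) (s : ℝ) : E d :=
  ((1 - s) ^ 2)⁻¹ • terminalMean Ω p₀ p₁ s (w s)

/-- The Picard operator whose fixed points are the rectified paths started at `x`. It integrates the
equation for `w t / (1 - t)` instead of the one for `w t`: in this form the integrand takes values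
in a cone over `Ω`, so that the operator preserves the distance to the boundary. -/
def picardStep (Ω : Set (E d)) (p₀ p₁ : E d → ℝ) (x : E d) (w : ℝ → E d) (t : ℝ) : E d :=
  (1 - t) • (x + ∫ s in (0 : ℝ)..t, rescaledVelocity Ω p₀ p₁ w s)

/-- `w` is a rectified path started at `x`, considered only on the time interval `[0, T]`. -/
structure IsRectifiedPathUpTo (Ω : Set (E d)) (p₀ p₁ : E d → ℝ) (x : E d) (T : ℝ)
    (w : ℝ → E d) : Prop where
  mem_continuousPaths : w ∈ continuousPaths (interior Ω) T
  integral_eq : ∀ t ∈ Icc 0 T, w t = x + ∫ s in (0 : ℝ)..t, velocity Ω p₀ p₁ s (w s)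

lemma IsRectifiedPathUpTo.mono {x : E d} {T T' : ℝ} {w : ℝ → E d}
    (hw : IsRectifiedPathUpTo Ω p₀ p₁ x T w) (hT : T' ≤ T) :
    IsRectifiedPathUpTo Ω p₀ p₁ x T' w :=
  ⟨continuousPaths_mono subset_rfl hT hw.mem_continuousPaths,
    fun t ht => hw.integral_eq t ⟨ht.1, ht.2.trans hT⟩⟩

lemma IsRectifiedPathUpTo.congr {x : E d} {T : ℝ} {w w' : ℝ → E d}
    (hw : IsRectifiedPathUpTo Ω p₀ p₁ x T w) (h : EqOn w' w (Icc 0 T)) :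
    IsRectifiedPathUpTo Ω p₀ p₁ x T w' := by
  refine ⟨⟨hw.mem_continuousPaths.1.congr h, hw.mem_continuousPaths.2.congr h.symm⟩,
    fun t ht => ?_⟩
  rw [h ht, hw.integral_eq t ht]
  congr 1
  refine intervalIntegral.integral_congr fun s hs => ?_
  rw [uIcc_of_le ht.1] at hs
  simp only [h ⟨hs.1, hs.2.trans ht.2⟩]

lemma hasDerivAt_inv_one_sub {s : ℝ} (hs : s < 1) :
    HasDerivAt (fun s : ℝ => (1 - s)⁻¹) ((1 - s) ^ 2)⁻¹ s := by
  have h : HasDerivAt (fun s : ℝ => (1 - s)⁻¹) (-(-1) / (1 - s) ^ 2) s :=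
    ((hasDerivAt_id s).const_sub 1).inv (sub_pos.2 hs).ne'
  simpa using h

lemma continuousOn_inv_one_sub_sq {T : ℝ} (hT : T < 1) :
    ContinuousOn (fun s : ℝ => ((1 - s) ^ 2)⁻¹) (Icc 0 T) :=
  ContinuousOn.inv₀ (by fun_prop) fun _ hs => (pow_pos (sub_pos.2 (hs.2.trans_lt hT)) 2).ne'

lemma integral_inv_one_sub_sq {t : ℝ} (h0 : 0 ≤ t) (h1 : t < 1) :
    ∫ s in (0 : ℝ)..t, ((1 - s) ^ 2)⁻¹ = t / (1 - t) := by
  rw [intervalIntegral.integral_eq_sub_of_hasDerivAt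
    (fun s hs => hasDerivAt_inv_one_sub ((uIcc_of_le h0 ▸ hs).2.trans_lt h1))
    ((continuousOn_inv_one_sub_sq h1).intervalIntegrable_of_Icc h0)]
  have : 1 - t ≠ 0 := (sub_pos.2 h1).ne'
  field_simp
  ring

lemma smul_add_integral_mem_erosion {x : E d} {ρ t : ℝ} {g : ℝ → E d} (hcl : IsClosed Ω)
    (hconv : Convex ℝ Ω) (hx : x ∈ erosion Ω ρ) (h0 : 0 ≤ t) (h1 : t < 1)
    (hg : ∀ s ∈ Icc 0 t, g s ∈ Ω)
    (hint : IntervalIntegrable (fun s => ((1 - s) ^ 2)⁻¹ • g s) volume 0 t) :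
    (1 - t) • (x + ∫ s in (0 : ℝ)..t, ((1 - s) ^ 2)⁻¹ • g s) ∈ erosion Ω ((1 - t) * ρ) := by
  rcases h0.eq_or_lt with rfl | hpos
  · simpa using hx
  have ht : 0 < 1 - t := sub_pos.2 h1
  have hmass := integral_inv_one_sub_sq h0 h1
  have hweight := (continuousOn_inv_one_sub_sq h1).intervalIntegrable_of_Icc (μ := volume) h0
  rw [intervalIntegrable_iff_integrableOn_Ioc_of_le h0] at hint hweight
  rw [intervalIntegral.integral_of_le h0] at hmass ⊢
  have hmean : (t / (1 - t))⁻¹ • ∫ s in Ioc 0 t, ((1 - s) ^ 2)⁻¹ • g s ∈ Ω := by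
    rw [← hmass]
    refine weighted_mean_mem hcl hconv hweight hint
      (ae_of_all _ fun s => inv_nonneg.2 (sq_nonneg _)) ?_ (by rw [hmass]; positivity)
    filter_upwards [ae_restrict_mem measurableSet_Ioc] with s hs _
    exact hg s ⟨hs.1.le, hs.2⟩
  convert smul_add_smul_mem_erosion hconv hx hmean ht h0 (sub_add_cancel 1 t) using 1
  rw [smul_add, smul_smul, inv_div, mul_div_cancel₀ _ hpos.ne']

lemma isClosed_erosion (hΩ : IsClosed Ω) (ρ : ℝ) : IsClosed (erosion Ω ρ) := by
  have h : erosion Ω ρ = ⋂ y ∈ Metric.closedBall (0 : E d) ρ, (fun x => x + y) ⁻¹' Ω := by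
    ext x
    simp only [erosion, mem_ofPred_eq, mem_iInter, mem_preimage]
    refine ⟨fun hx y hy => hx (by simpa using hy), fun hx y hy => ?_⟩
    simpa using hx (y - x) (by simpa [dist_eq_norm] using hy)
  rw [h]
  exact isClosed_biInter fun y _ => hΩ.preimage (by fun_prop)

lemma rescaledVelocity_eq (w : ℝ → E d) {s : ℝ} (hs : s < 1) :
    rescaledVelocity Ω p₀ p₁ w s =
      (1 - s)⁻¹ • velocity Ω p₀ p₁ s (w s) + ((1 - s) ^ 2)⁻¹ • w s := by
  have h : 1 - s ≠ 0 := (sub_pos.2 hs).ne'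
  rw [rescaledVelocity, terminalMean, smul_add, smul_smul,
    show ((1 - s) ^ 2)⁻¹ * (1 - s) = (1 - s)⁻¹ by field_simp, add_comm]

namespace Admissible

variable (H : Admissible Ω p₀ p₁) {x : E d} {w : ℝ → E d} {T : ℝ}
include H

lemma continuousOn_velocity_comp (hT : T ≤ 1) (hw : w ∈ continuousPaths (interior Ω) T) :
    ContinuousOn (fun s => velocity Ω p₀ p₁ s (w s)) (Icc 0 T) := fun t ht =>
  ContinuousAt.comp_continuousWithinAt (f := fun s => (s, w s))
    (g := fun q : ℝ × E d => velocity Ω p₀ p₁ q.1 q.2)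
    (H.continuousAt_velocity ⟨ht.1, ht.2.trans hT⟩ (hw.2 ht))
    (continuousWithinAt_id.prodMk (hw.1 t ht))

lemma continuousOn_rescaledVelocity (hT : T < 1) (hw : w ∈ continuousPaths (interior Ω) T) :
    ContinuousOn (rescaledVelocity Ω p₀ p₁ w) (Icc 0 T) :=
  have h : ContinuousOn (fun s : ℝ => 1 - s) (Icc 0 T) := by fun_prop
  (continuousOn_inv_one_sub_sq hT).smul <|
    hw.1.add <| h.smul (H.continuousOn_velocity_comp hT.le hw)

lemma continuousOn_picardStep (hT : T < 1) (hw : w ∈ continuousPaths (interior Ω) T) :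
    ContinuousOn (picardStep Ω p₀ p₁ x w) (Icc 0 T) :=
  have h : ContinuousOn (fun s : ℝ => 1 - s) (Icc 0 T) := by fun_prop
  h.smul <| continuousOn_const.add <|
    continuousOn_integral_zero (H.continuousOn_rescaledVelocity hT hw).integrableOn_Icc

lemma picardStep_mem_erosion {ρ : ℝ} (hT : T < 1) (hx : x ∈ erosion Ω ρ)
    (hw : w ∈ continuousPaths (interior Ω) T) {t : ℝ} (ht : t ∈ Icc 0 T) :
    picardStep Ω p₀ p₁ x w t ∈ erosion Ω ((1 - t) * ρ) :=
  smul_add_integral_mem_erosion H.compact.isClosed H.convex hx ht.1 (ht.2.trans_lt hT)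
    (fun _ hs => (H.velocity_mem_displacements ⟨hs.1, ((hs.2.trans ht.2).trans_lt hT).le⟩
      (hw.2 ⟨hs.1, hs.2.trans ht.2⟩)).2)
    (intervalIntegrable_zero_of_continuousOn (H.continuousOn_rescaledVelocity hT hw) ht)

lemma eqOn_picardStep (hT : T < 1) (hw : IsRectifiedPathUpTo Ω p₀ p₁ x T w) :
    EqOn (picardStep Ω p₀ p₁ x w) w (Icc 0 T) := by
  intro t ht
  have hpos : ∀ s ∈ Icc 0 t, 0 < 1 - s := fun s hs =>
    sub_pos.2 ((hs.2.trans ht.2).trans_lt hT)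
  have hsub : Icc 0 t ⊆ Icc 0 T := Icc_subset_Icc_right ht.2
  have hderiv : ∀ s ∈ Ioo 0 t, HasDerivAt w (velocity Ω p₀ p₁ s (w s)) s := by
    intro s hs
    refine ((hasDerivAt_integral_zero (H.continuousOn_velocity_comp hT.le hw.mem_continuousPaths)
      ⟨hs.1, hs.2.trans_le ht.2⟩).const_add x).congr_of_eventuallyEq ?_
    filter_upwards [Icc_mem_nhds hs.1 hs.2] with r hr using hw.integral_eq r (hsub hr)
  have hrescaled : ∀ s ∈ Ioo 0 t,
      HasDerivAt (fun s => (1 - s)⁻¹ • w s) (rescaledVelocity Ω p₀ p₁ w s) s := by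
    intro s hs
    have hs1 : s < 1 := sub_pos.1 (hpos s (Ioo_subset_Icc_self hs))
    rw [rescaledVelocity_eq w hs1]
    exact (hasDerivAt_inv_one_sub hs1).smul (hderiv s hs)
  have hcont : ContinuousOn (fun s => (1 - s)⁻¹ • w s) (Icc 0 t) :=
    (ContinuousOn.inv₀ (by fun_prop) fun s hs => (hpos s hs).ne').smul
      (hw.mem_continuousPaths.1.mono hsub)
  have hFTC := intervalIntegral.integral_eq_sub_of_hasDerivAt_of_le ht.1 hcont hrescaled
    (intervalIntegrable_zero_of_continuousOn
      (H.continuousOn_rescaledVelocity hT hw.mem_continuousPaths) ht)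
  have hw0 : w 0 = x := by simpa using hw.integral_eq 0 ⟨le_rfl, ht.1.trans ht.2⟩
  simp only [picardStep, hFTC, hw0, sub_zero, inv_one, one_smul, add_sub_cancel]
  exact smul_inv_smul₀ (hpos t (right_mem_Icc.2 ht.1)).ne' _

lemma isRectifiedPathUpTo_of_eqOn (hT : T < 1) (hw : w ∈ continuousPaths (interior Ω) T)
    (heq : EqOn (picardStep Ω p₀ p₁ x w) w (Icc 0 T)) : IsRectifiedPathUpTo Ω p₀ p₁ x T w := by
  refine ⟨hw, fun t ht => ?_⟩
  have hderiv : ∀ s ∈ Ioo 0 t,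
      HasDerivAt (picardStep Ω p₀ p₁ x w) (velocity Ω p₀ p₁ s (w s)) s := by
    intro s hs
    have hsT : s ∈ Ioo 0 T := ⟨hs.1, hs.2.trans_le ht.2⟩
    have hs1 : 0 < 1 - s := sub_pos.2 (hsT.2.trans hT)
    have h := ((hasDerivAt_id s).const_sub 1).smul <|
      (hasDerivAt_integral_zero (H.continuousOn_rescaledVelocity hT hw) hsT).const_add x
    refine h.congr_deriv ?_
    have hws : x + ∫ r in (0 : ℝ)..s, rescaledVelocity Ω p₀ p₁ w r = (1 - s)⁻¹ • w s := by
      rw [← heq (Ioo_subset_Icc_self hsT), picardStep, inv_smul_smul₀ hs1.ne']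
    rw [hws, rescaledVelocity_eq w (hsT.2.trans hT)]
    match_scalars <;> field_simp <;> simp
  have hFTC := intervalIntegral.integral_eq_sub_of_hasDerivAt_of_le ht.1
    ((H.continuousOn_picardStep hT hw).mono (Icc_subset_Icc_right ht.2)) hderiv
    (intervalIntegrable_zero_of_continuousOn (H.continuousOn_velocity_comp hT.le hw) ht)
  have h0 : picardStep Ω p₀ p₁ x w 0 = x := by simp [picardStep]
  rw [hFTC, h0, add_sub_cancel, heq ht]

lemma norm_rescaledVelocity_sub_le {ρ s : ℝ} {w' : ℝ → E d} (hρ : 0 < ρ) (hT : T < 1)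
    (hs : s ∈ Icc 0 T) (hws : w s ∈ erosion Ω ρ) (hws' : w' s ∈ erosion Ω ρ) :
    ‖rescaledVelocity Ω p₀ p₁ w s - rescaledVelocity Ω p₀ p₁ w' s‖ ≤
      ((1 - T) ^ 2)⁻¹ * (1 + velocityConst d (Metric.diam Ω) (omegaInvOne Ω p₀ p₁) * (1 + 1 / ρ)) *
        velocityModulus Ω p₀ p₁ (dist (w s) (w' s)) := by
  set v := velocity Ω p₀ p₁ s (w s)
  set v' := velocity Ω p₀ p₁ s (w' s)
  set K := velocityConst d (Metric.diam Ω) (omegaInvOne Ω p₀ p₁) * (1 + 1 / ρ)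
  set u := dist (w s) (w' s) with hu
  have hs1 : 0 ≤ 1 - s := by linarith [hs.2]
  have hv : ‖v - v'‖ ≤ K * velocityModulus Ω p₀ p₁ u := by
    rw [hu, dist_eq_norm]
    exact H.norm_velocity_sub_le ⟨hs.1, hs.2.trans hT.le⟩ hρ hws hws'
  have hmean : ‖(w s + (1 - s) • v) - (w' s + (1 - s) • v')‖ ≤
      (1 + K) * velocityModulus Ω p₀ p₁ u :=
    calc ‖(w s + (1 - s) • v) - (w' s + (1 - s) • v')‖
        = ‖(w s - w' s) + (1 - s) • (v - v')‖ := by congr 1; module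
      _ ≤ ‖w s - w' s‖ + (1 - s) * ‖v - v'‖ := by
        simpa only [norm_smul, Real.norm_of_nonneg hs1] using
          norm_add_le (w s - w' s) ((1 - s) • (v - v'))
      _ ≤ velocityModulus Ω p₀ p₁ u + 1 * (K * velocityModulus Ω p₀ p₁ u) := by
        rw [← dist_eq_norm, ← hu]
        gcongr
        · exact le_add_of_nonneg_right (omega_nonneg u)
        · linarith [hs.1]
      _ = (1 + K) * velocityModulus Ω p₀ p₁ u := by ring
  rw [rescaledVelocity, rescaledVelocity, ← smul_sub, norm_smul,
    Real.norm_of_nonneg (by positivity), mul_assoc]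
  have : 0 < 1 - T := sub_pos.2 hT
  gcongr
  · exact hs.2
  · exact hmean

lemma exists_dist_picardStep_le {ρ : ℝ} (hρ : 0 < ρ) (hT : T < 1) : ∃ K ≥ 0,
    ∀ w ∈ continuousPaths (erosion Ω ρ) T, ∀ w' ∈ continuousPaths (erosion Ω ρ) T,
      ∀ t ∈ Icc 0 T, dist (picardStep Ω p₀ p₁ x w t) (picardStep Ω p₀ p₁ x w' t) ≤
        K * ∫ s in (0 : ℝ)..t, velocityModulus Ω p₀ p₁ (dist (w s) (w' s)) := by
  have hA := velocityConst_pos d (Metric.diam Ω) (omegaInvOne Ω p₀ p₁)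
  refine ⟨_, by positivity, fun w hw w' hw' t ht => (?_ : _ ≤ ((1 - T) ^ 2)⁻¹ * (1 +
    velocityConst d (Metric.diam Ω) (omegaInvOne Ω p₀ p₁) * (1 + 1 / ρ)) * _)⟩
  have hint : ∀ w ∈ continuousPaths (erosion Ω ρ) T,
      IntervalIntegrable (rescaledVelocity Ω p₀ p₁ w) volume 0 t := fun w hw =>
    intervalIntegrable_zero_of_continuousOn (H.continuousOn_rescaledVelocity hT
      (continuousPaths_mono (erosion_subset_interior hρ) le_rfl hw)) ht
  have ht1 : 0 ≤ 1 - t := by linarith [ht.2]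
  rw [dist_eq_norm, picardStep, picardStep, ← smul_sub, add_sub_add_left_eq_sub,
    ← intervalIntegral.integral_sub (hint w hw) (hint w' hw'), norm_smul, Real.norm_of_nonneg ht1]
  refine (mul_le_of_le_one_left (norm_nonneg _) (by linarith [ht.1])).trans ?_
  rw [← intervalIntegral.integral_const_mul]
  refine (intervalIntegral.norm_integral_le_integral_norm ht.1).trans <|
    intervalIntegral.integral_mono_on ht.1 ((hint w hw).sub (hint w' hw')).norm ?_ fun s hs => ?_
  · exact intervalIntegrable_zero_of_continuousOn (continuousOn_const.mul <|
      H.isModulus_velocityModulus.continuous.comp_continuousOn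
        (continuous_dist.comp_continuousOn (hw.1.prodMk hw'.1))) ht
  · have hsT : s ∈ Icc 0 T := ⟨hs.1, hs.2.trans ht.2⟩
    exact H.norm_rescaledVelocity_sub_le hρ hT hsT (hw.2 hsT) (hw'.2 hsT)

variable {a : ℝ}

theorem exists_isRectifiedPathUpTo (ha : 0 < a) (hΨ : Tendsto (Psi Ω p₀ p₁ a) (𝓝[>] 0) atBot)
    (hx : x ∈ interior Ω) (hT : T ∈ Ico (0 : ℝ) 1) :
    ∃ w, IsRectifiedPathUpTo Ω p₀ p₁ x T w := by
  obtain ⟨ρ, hρ, hxρ⟩ := exists_mem_erosion hx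
  have hρT : 0 < (1 - T) * ρ := mul_pos (sub_pos.2 hT.2) hρ
  have hinterior : continuousPaths (erosion Ω ((1 - T) * ρ)) T ⊆ continuousPaths (interior Ω) T :=
    continuousPaths_mono (erosion_subset_interior hρT) le_rfl
  have hmaps : MapsTo (picardStep Ω p₀ p₁ x) (continuousPaths (erosion Ω ((1 - T) * ρ)) T)
      (continuousPaths (erosion Ω ((1 - T) * ρ)) T) := fun w hw =>
    ⟨H.continuousOn_picardStep hT.2 (hinterior hw), fun t ht => erosion_anti (by gcongr; exact ht.2)
      (H.picardStep_mem_erosion hT.2 hxρ (hinterior hw) ht)⟩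
  obtain ⟨K, hK, hdist⟩ := H.exists_dist_picardStep_le (x := x) hρT hT.2
  obtain ⟨w, hw, heq⟩ := H.isModulus_velocityModulus.exists_fixedPoint ha hΨ hK
    (isClosed_erosion H.compact.isClosed _).isComplete
    (H.compact.isBounded.subset (erosion_subset hρT.le))
    ⟨x, erosion_anti (mul_le_of_le_one_left hρ.le (by linarith [hT.1])) hxρ⟩ hmaps hdist
  exact ⟨w, H.isRectifiedPathUpTo_of_eqOn hT.2 (hinterior hw) heq⟩

lemma pathUpTo_mem_erosion {ρ : ℝ} (hT : T < 1) (hw : IsRectifiedPathUpTo Ω p₀ p₁ x T w)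
    (hx : x ∈ erosion Ω ρ) {t : ℝ} (ht : t ∈ Icc 0 T) : w t ∈ erosion Ω ((1 - t) * ρ) :=
  H.eqOn_picardStep hT hw ht ▸ H.picardStep_mem_erosion hT hx hw.mem_continuousPaths ht

theorem eqOn_of_isRectifiedPathUpTo (ha : 0 < a) (hΨ : Tendsto (Psi Ω p₀ p₁ a) (𝓝[>] 0) atBot)
    (hx : x ∈ interior Ω) (hT : T < 1) {w' : ℝ → E d} (hw : IsRectifiedPathUpTo Ω p₀ p₁ x T w)
    (hw' : IsRectifiedPathUpTo Ω p₀ p₁ x T w') : EqOn w w' (Icc 0 T) := by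
  obtain ⟨ρ, hρ, hxρ⟩ := exists_mem_erosion hx
  have hρT : 0 < (1 - T) * ρ := mul_pos (sub_pos.2 hT) hρ
  have hmem : ∀ {w}, IsRectifiedPathUpTo Ω p₀ p₁ x T w →
      w ∈ continuousPaths (erosion Ω ((1 - T) * ρ)) T := fun hw =>
    ⟨hw.mem_continuousPaths.1, fun t ht => erosion_anti (by gcongr; exact ht.2)
      (H.pathUpTo_mem_erosion hT hw hxρ ht)⟩
  obtain ⟨K, hK, hdist⟩ := H.exists_dist_picardStep_le (x := x) hρT hT
  intro t ht
  refine dist_eq_zero.1 <| H.isModulus_velocityModulus.eq_zero_of_le_integral ha hΨ hK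
    (continuous_dist.comp_continuousOn (hw.mem_continuousPaths.1.prodMk hw'.mem_continuousPaths.1))
    (fun _ _ => dist_nonneg) (fun s hs => ?_) t ht
  have h := hdist w (hmem hw) w' (hmem hw') s hs
  rwa [H.eqOn_picardStep hT hw hs, H.eqOn_picardStep hT hw' hs] at h

end Admissible

/-! ### Rectified paths up to time `1` -/

lemma IsRectifiedPath.intervalIntegrable {x : E d} {z : ℝ → E d}
    (hz : IsRectifiedPath Ω p₀ p₁ x z) {t : ℝ} (ht : t ∈ Icc (0 : ℝ) 1) :
    IntervalIntegrable (fun s => velocity Ω p₀ p₁ s (z s)) volume 0 t :=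
  hz.integrable.mono_set <| by
    rw [uIcc_of_le ht.1, uIcc_of_le zero_le_one]
    exact Icc_subset_Icc_right ht.2

namespace Admissible

variable (H : Admissible Ω p₀ p₁) {a : ℝ} {x : E d} {z : ℝ → E d}
include H

lemma exists_forall_isRectifiedPathUpTo (ha : 0 < a)
    (hΨ : Tendsto (Psi Ω p₀ p₁ a) (𝓝[>] 0) atBot) (hx : x ∈ interior Ω) :
    ∃ z, ∀ T ∈ Ico (0 : ℝ) 1, IsRectifiedPathUpTo Ω p₀ p₁ x T z := by
  choose! w hw using fun (T : ℝ) (hT : T ∈ Ico 0 1) => H.exists_isRectifiedPathUpTo ha hΨ hx hT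
  refine ⟨fun t => w t t, fun T hT => (hw T hT).congr fun t ht => ?_⟩
  have ht1 : t < 1 := ht.2.trans_lt hT.2
  exact H.eqOn_of_isRectifiedPathUpTo ha hΨ hx ht1 (hw t ⟨ht.1, ht1⟩) ((hw T hT).mono ht.2)
    (right_mem_Icc.2 ht.1)

lemma intervalIntegrable_velocity_comp
    (hz : ∀ T ∈ Ico (0 : ℝ) 1, IsRectifiedPathUpTo Ω p₀ p₁ x T z) :
    IntervalIntegrable (fun s => velocity Ω p₀ p₁ s (z s)) volume 0 1 := by
  have hcont : ContinuousOn (fun s => velocity Ω p₀ p₁ s (z s)) (Ioo 0 1) := by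
    intro t ht
    obtain ⟨T, htT, hT⟩ := exists_between ht.2
    have hT0 : 0 < T := ht.1.trans htT
    exact ((H.continuousOn_velocity_comp hT.le (hz T ⟨hT0.le, hT⟩).mem_continuousPaths).continuousAt
      (Icc_mem_nhds ht.1 htT)).continuousWithinAt
  rw [intervalIntegrable_iff_integrableOn_Ioo_of_le zero_le_one]
  refine ⟨hcont.aestronglyMeasurable measurableSet_Ioo, .of_bounded (C := Metric.diam Ω) ?_⟩
  filter_upwards [ae_restrict_mem measurableSet_Ioo] with t ht
  have ht' : t ∈ Ico (0 : ℝ) 1 := Ioo_subset_Ico_self ht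
  exact H.norm_velocity_le (Ico_subset_Icc_self ht')
    ((hz t ht').mem_continuousPaths.2 (right_mem_Icc.2 ht'.1))

theorem exists_isRectifiedPath (ha : 0 < a) (hΨ : Tendsto (Psi Ω p₀ p₁ a) (𝓝[>] 0) atBot)
    (hx : x ∈ interior Ω) : ∃ z, IsRectifiedPath Ω p₀ p₁ x z := by
  obtain ⟨z, hz⟩ := H.exists_forall_isRectifiedPathUpTo ha hΨ hx
  let y : ℝ → E d := fun t => x + ∫ s in (0 : ℝ)..t, velocity Ω p₀ p₁ s (z s)
  have hyz : ∀ t ∈ Ico (0 : ℝ) 1, y t = z t := fun t ht =>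
    ((hz t ht).integral_eq t (right_mem_Icc.2 ht.1)).symm
  have hvel : ∀ t ∈ Icc (0 : ℝ) 1, ∀ᵐ s, s ∈ uIoc 0 t →
      velocity Ω p₀ p₁ s (z s) = velocity Ω p₀ p₁ s (y s) := by
    intro t ht
    filter_upwards [Measure.ae_ne volume (1 : ℝ)] with s hs1 hs
    rw [uIoc_of_le ht.1] at hs
    rw [hyz s ⟨hs.1.le, (hs.2.trans ht.2).lt_of_ne hs1⟩]
  refine ⟨y, ⟨fun t ht => ?_, ?_, fun t ht => ?_⟩⟩
  · exact hyz t ht ▸ (hz t ht).mem_continuousPaths.2 (right_mem_Icc.2 ht.1)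
  · exact (H.intervalIntegrable_velocity_comp hz).congr_ae
      ((ae_restrict_iff' measurableSet_uIoc).2 (hvel 1 (right_mem_Icc.2 zero_le_one)))
  · exact congrArg (x + ·) (intervalIntegral.integral_congr_ae (hvel t ht))

lemma norm_path_sub_le (hz : IsRectifiedPath Ω p₀ p₁ x z) {s t : ℝ} (hs : s ∈ Icc (0 : ℝ) 1)
    (ht : t ∈ Icc (0 : ℝ) 1) : ‖z t - z s‖ ≤ Metric.diam Ω * |t - s| := by
  rw [hz.integral_eq t ht, hz.integral_eq s hs, add_sub_add_left_eq_sub,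
    intervalIntegral.integral_interval_sub_left (hz.intervalIntegrable ht)
      (hz.intervalIntegrable hs)]
  refine intervalIntegral.norm_integral_le_of_norm_le_const_ae ?_
  filter_upwards [Measure.ae_ne volume (1 : ℝ)] with u hu1 hu
  have hu' : u ∈ Icc (0 : ℝ) 1 := uIcc_subset_Icc hs ht (uIoc_subset_uIcc hu)
  exact H.norm_velocity_le hu' (hz.mem_interior u ⟨hu'.1, hu'.2.lt_of_ne hu1⟩)

lemma continuousOn_path (hz : IsRectifiedPath Ω p₀ p₁ x z) : ContinuousOn z (Icc 0 1) := by
  refine (LipschitzOnWith.of_dist_le_mul (K := ⟨Metric.diam Ω, Metric.diam_nonneg⟩)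
    fun t ht s hs => ?_).continuousOn
  rw [dist_eq_norm, Real.dist_eq]
  exact H.norm_path_sub_le hz hs ht

lemma isRectifiedPathUpTo (hz : IsRectifiedPath Ω p₀ p₁ x z) {T : ℝ} (hT : T < 1) :
    IsRectifiedPathUpTo Ω p₀ p₁ x T z :=
  ⟨⟨(H.continuousOn_path hz).mono (Icc_subset_Icc_right hT.le),
    fun t ht => hz.mem_interior t ⟨ht.1, ht.2.trans_lt hT⟩⟩,
    fun t ht => hz.integral_eq t ⟨ht.1, ht.2.trans hT.le⟩⟩

lemma path_mem_erosion {ρ t : ℝ} (hz : IsRectifiedPath Ω p₀ p₁ x z) (hx : x ∈ erosion Ω ρ)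
    (ht : t ∈ Ico (0 : ℝ) 1) : z t ∈ erosion Ω ((1 - t) * ρ) :=
  H.pathUpTo_mem_erosion ht.2 (H.isRectifiedPathUpTo hz ht.2) hx (right_mem_Icc.2 ht.1)

lemma path_mem (hz : IsRectifiedPath Ω p₀ p₁ x z) {t : ℝ} (ht : t ∈ Icc (0 : ℝ) 1) : z t ∈ Ω := by
  have hmaps : MapsTo z (Ico 0 1) Ω := fun s hs => interior_subset (hz.mem_interior s hs)
  have hcl : closure (Ico (0 : ℝ) 1) = Icc 0 1 := closure_Ico zero_ne_one
  exact H.compact.isClosed.closure_subset <|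
    hmaps.closure_of_continuousOn (hcl ▸ H.continuousOn_path hz) (hcl ▸ ht)

theorem path_unique (ha : 0 < a) (hΨ : Tendsto (Psi Ω p₀ p₁ a) (𝓝[>] 0) atBot)
    (hx : x ∈ interior Ω) {z' : ℝ → E d} (hz : IsRectifiedPath Ω p₀ p₁ x z)
    (hz' : IsRectifiedPath Ω p₀ p₁ x z') : EqOn z z' (Icc 0 1) := by
  have heq : EqOn z z' (Ico 0 1) := fun t ht =>
    H.eqOn_of_isRectifiedPathUpTo ha hΨ hx ht.2 (H.isRectifiedPathUpTo hz ht.2)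
      (H.isRectifiedPathUpTo hz' ht.2) (right_mem_Icc.2 ht.1)
  exact heq.of_subset_closure (H.continuousOn_path hz) (H.continuousOn_path hz')
    Ico_subset_Icc_self (closure_Ico zero_ne_one).ge

/-! ### Stability of rectified paths -/

variable {x' : E d} {z' : ℝ → E d} {η r : ℝ}

lemma norm_path_sub_path_le {ρ T : ℝ} (ha : 0 < a) (hz : IsRectifiedPath Ω p₀ p₁ x z)
    (hz' : IsRectifiedPath Ω p₀ p₁ x' z') (hη : 0 < η) (hxx : ‖x - x'‖ ≤ η) (hρ : 0 < ρ)
    (hT : T ≤ 1) (hmem : ∀ t ∈ Ico 0 T, z t ∈ erosion Ω ρ)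
    (hmem' : ∀ t ∈ Ico 0 T, z' t ∈ erosion Ω ρ) (hr : 0 < r)
    (hηr : Psi Ω p₀ p₁ a η +
      velocityConst d (Metric.diam Ω) (omegaInvOne Ω p₀ p₁) * (1 + 1 / ρ) ≤ Psi Ω p₀ p₁ a r) :
    ∀ t ∈ Icc 0 T, ‖z t - z' t‖ ≤ r := by
  set K := velocityConst d (Metric.diam Ω) (omegaInvOne Ω p₀ p₁) * (1 + 1 / ρ)
  have hK : 0 ≤ K := mul_nonneg (velocityConst_pos _ _ _).le (by positivity)
  have hsub : Icc 0 T ⊆ Icc (0 : ℝ) 1 := Icc_subset_Icc_right hT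
  have hcont : ContinuousOn (fun t => ‖z t - z' t‖) (Icc 0 T) :=
    (((H.continuousOn_path hz).mono hsub).sub ((H.continuousOn_path hz').mono hsub)).norm
  refine H.isModulus_velocityModulus.osgood_inequality ha hη hK hcont (fun _ _ => norm_nonneg _)
    (fun t ht => ?_) hr ((add_le_add_right (mul_le_of_le_one_right hK hT) _).trans hηr)
  have hint := hz.intervalIntegrable (hsub ht)
  have hint' := hz'.intervalIntegrable (hsub ht)
  rw [hz.integral_eq t (hsub ht), hz'.integral_eq t (hsub ht), add_sub_add_comm,
    ← intervalIntegral.integral_sub hint hint', ← intervalIntegral.integral_const_mul]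
  refine (norm_add_le _ _).trans (add_le_add hxx ?_)
  refine (intervalIntegral.norm_integral_le_integral_norm ht.1).trans <|
    intervalIntegral.integral_mono_on_of_le_Ioo ht.1 (hint.sub hint').norm ?_ fun s hs => ?_
  · exact intervalIntegrable_zero_of_continuousOn (continuousOn_const.mul <|
      H.isModulus_velocityModulus.continuous.comp_continuousOn hcont) ht
  · have hs' : s ∈ Ico 0 T := ⟨hs.1.le, hs.2.trans_le ht.2⟩
    exact H.norm_velocity_sub_le ⟨hs'.1, hs'.2.le.trans hT⟩ hρ (hmem s hs') (hmem' s hs')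

/- Near the final time the distance to the boundary may degenerate, so Osgood's inequality is used
only up to the time `1 - τ`; afterwards the speed is at most `diam Ω`. -/
lemma norm_path_sub_path_le_add {ε τ : ℝ} (ha : 0 < a) (hz : IsRectifiedPath Ω p₀ p₁ x z)
    (hz' : IsRectifiedPath Ω p₀ p₁ x' z') (hη : 0 < η) (hxx : ‖x - x'‖ ≤ η) (hε : 0 < ε)
    (hx : x ∈ erosion Ω ε) (hx' : x' ∈ erosion Ω ε) (hτ : 0 < τ) (hτ1 : τ ≤ 1) (hr : 0 < r)
    (hηr : Psi Ω p₀ p₁ a η + velocityConst d (Metric.diam Ω) (omegaInvOne Ω p₀ p₁) *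
      (1 + 1 / (τ * ε)) ≤ Psi Ω p₀ p₁ a r) {t : ℝ} (ht : t ∈ Icc (0 : ℝ) 1) :
    ‖z t - z' t‖ ≤ r + 2 * Metric.diam Ω * τ := by
  have hmem : ∀ {x z}, IsRectifiedPath Ω p₀ p₁ x z → x ∈ erosion Ω ε →
      ∀ t ∈ Ico 0 (1 - τ), z t ∈ erosion Ω (τ * ε) := fun hz hx t ht =>
    erosion_anti (mul_le_mul_of_nonneg_right (by linarith [ht.2]) hε.le)
      (H.path_mem_erosion hz hx ⟨ht.1, by linarith [ht.2]⟩)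
  have hmiddle := H.norm_path_sub_path_le ha hz hz' hη hxx (mul_pos hτ hε)
    (by linarith : 1 - τ ≤ 1) (hmem hz hx) (hmem hz' hx') hr hηr
  have hD : 0 ≤ Metric.diam Ω * τ := mul_nonneg Metric.diam_nonneg hτ.le
  rcases le_total t (1 - τ) with h | h
  · linarith [hmiddle t ⟨ht.1, h⟩]
  · have hτmem : 1 - τ ∈ Icc (0 : ℝ) 1 := ⟨by linarith, by linarith⟩
    have hspeed : ∀ {x z}, IsRectifiedPath Ω p₀ p₁ x z →
        ‖z t - z (1 - τ)‖ ≤ Metric.diam Ω * τ := fun hz =>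
      (H.norm_path_sub_le hz hτmem ht).trans <| mul_le_mul_of_nonneg_left
        (abs_le.2 ⟨by linarith, by linarith [ht.2]⟩) Metric.diam_nonneg
    calc ‖z t - z' t‖
        = ‖(z t - z (1 - τ)) + (z (1 - τ) - z' (1 - τ)) - (z' t - z' (1 - τ))‖ := by
          congr 1; module
      _ ≤ ‖z t - z (1 - τ)‖ + ‖z (1 - τ) - z' (1 - τ)‖ + ‖z' t - z' (1 - τ)‖ :=
        (norm_sub_le _ _).trans (add_le_add_left (norm_add_le _ _) _)
      _ ≤ Metric.diam Ω * τ + r + Metric.diam Ω * τ := by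
        gcongr
        exacts [hspeed hz, hmiddle _ ⟨hτmem.1, le_rfl⟩, hspeed hz']
      _ = r + 2 * Metric.diam Ω * τ := by ring

lemma exists_norm_path_sub_path_le {ε : ℝ} (ha : 0 < a)
    (hΨ : Tendsto (Psi Ω p₀ p₁ a) (𝓝[>] 0) atBot) (hε : 0 < ε) (hr : 0 < r) :
    ∃ η > 0, ∀ (x x' : E d) (z z' : ℝ → E d), IsRectifiedPath Ω p₀ p₁ x z →
      IsRectifiedPath Ω p₀ p₁ x' z' → x ∈ erosion Ω ε → x' ∈ erosion Ω ε →
      ‖x - x'‖ ≤ η → ∀ t ∈ Icc (0 : ℝ) 1, ‖z t - z' t‖ ≤ r := by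
  have : 0 ≤ Metric.diam Ω := Metric.diam_nonneg
  set τ := min 1 (r / (4 * (Metric.diam Ω + 1)))
  have hτ : 0 < τ := lt_min one_pos (by positivity)
  have hDτ : 2 * Metric.diam Ω * τ ≤ r / 2 :=
    calc 2 * Metric.diam Ω * τ
        ≤ 2 * (Metric.diam Ω + 1) * (r / (4 * (Metric.diam Ω + 1))) := by
          gcongr
          exacts [by linarith, min_le_right _ _]
      _ = r / 2 := by field_simp; ring
  obtain ⟨η, hη, hηr⟩ := exists_pos_add_le_of_tendsto_atBot hΨ
    (velocityConst d (Metric.diam Ω) (omegaInvOne Ω p₀ p₁) * (1 + 1 / (τ * ε)))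
    (Psi Ω p₀ p₁ a (r / 2))
  refine ⟨η, hη, fun x x' z z' hz hz' hx hx' hxx t ht => ?_⟩
  linarith [H.norm_path_sub_path_le_add ha hz hz' hη hxx hε hx hx' hτ (min_le_left _ _)
    (half_pos hr) hηr ht]

end Admissible

/-! ### Moduli of continuity along rectified paths -/

lemma log_diam_div_nonneg (hd : 1 ≤ d) (hΩ : Bornology.IsBounded Ω) {x : E d} {ε : ℝ} (hε : 0 < ε)
    (hx : x ∈ erosion Ω ε) : 0 ≤ Real.log (Metric.diam Ω / ε) :=
  Real.log_nonneg <| (one_le_div hε).2 <| by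
    linarith [two_mul_le_diam_of_mem_erosion hd hΩ hε.le hx]

lemma awayExponent_nonneg (hd : 1 ≤ d) (hΩ : Bornology.IsBounded Ω) {x : E d}
    {C₁ C₂ C₃ ε γ : ℝ} (hC₁ : 0 ≤ C₁) (hC₂ : 0 ≤ C₂) (hC₃ : 0 ≤ C₃) (hε : 0 < ε) (hγ : 0 < γ)
    (hx : x ∈ erosion Ω ε) : 0 ≤ awayExponent Ω C₁ C₂ C₃ ε γ := by
  have := log_diam_div_nonneg hd hΩ hε hx
  have := lt_min hε hγ
  unfold awayExponent
  positivity

lemma abs_div_sub_one_le_of_lipschitzOnWith {p : E d → ℝ} {K : NNReal} {c : ℝ} (hc : 0 < c)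
    (hpc : ∀ x ∈ Ω, c ≤ p x) (hp : LipschitzOnWith K p Ω) {x y : E d} (hx : x ∈ Ω) (hy : y ∈ Ω) :
    |p x / p y - 1| ≤ K / c * ‖x - y‖ := by
  have hpy : 0 < p y := hc.trans_le (hpc y hy)
  have hdist := hp.dist_le_mul x hx y hy
  rw [Real.dist_eq, dist_eq_norm] at hdist
  rw [div_sub_one hpy.ne', abs_div, abs_of_pos hpy, div_mul_eq_mul_div]
  exact div_le_div₀ (by positivity) hdist hc (hpc y hy)

namespace Admissible

variable (H : Admissible Ω p₀ p₁) {a η ε : ℝ} {x x' : E d} {z z' : ℝ → E d}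
include H

/- The stopping time `1 - τ` of `norm_path_sub_path_le_add` balances the two errors: its cost
`A / (τ ε)` in the Osgood bound is half of `-Ψ η`, up to `A / ε`. -/
lemma norm_path_sub_path_le_of_Psi_le {r : ℝ} (ha : 0 < a) (hz : IsRectifiedPath Ω p₀ p₁ x z)
    (hz' : IsRectifiedPath Ω p₀ p₁ x' z') (hη : 0 < η) (hxx : ‖x - x'‖ ≤ η) (hε : 0 < ε)
    (hx : x ∈ erosion Ω ε) (hx' : x' ∈ erosion Ω ε) (hr : 0 < r) {A : ℝ}
    (hA : A = velocityConst d (Metric.diam Ω) (omegaInvOne Ω p₀ p₁))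
    (hsmall : Psi Ω p₀ p₁ a η ≤ -(4 * A) / ε)
    (hηr : Psi Ω p₀ p₁ a η / 2 + A ≤ Psi Ω p₀ p₁ a r) {t : ℝ} (ht : t ∈ Icc (0 : ℝ) 1) :
    ‖z t - z' t‖ ≤ r + 2 * Metric.diam Ω * (4 * A / (4 * A - ε * Psi Ω p₀ p₁ a η)) := by
  have hA0 : 0 < A := hA ▸ velocityConst_pos _ _ _
  have hεΨ : Psi Ω p₀ p₁ a η * ε ≤ -(4 * A) := (le_div_iff₀ hε).1 hsmall
  set y := Psi Ω p₀ p₁ a η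
  have hden : 0 < 4 * A - ε * y := by linarith
  refine H.norm_path_sub_path_le_add ha hz hz' hη hxx hε hx hx' (div_pos (by positivity) hden)
    ((div_le_one hden).2 (by linarith)) hr ?_ ht
  have hcost : A * (1 / (4 * A / (4 * A - ε * y) * ε)) = (4 * A - ε * y) / (4 * ε) := by
    field_simp
  have hhalf : (4 * A - ε * y) / (4 * ε) ≤ -y / 2 := by
    rw [div_le_iff₀ (by positivity)]
    linarith
  rw [← hA, mul_add, hcost]
  linarith

lemma norm_path_sub_path_le_globalModulus (hd : 1 ≤ d) (ha : 0 < a)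
    (hΨ : Tendsto (Psi Ω p₀ p₁ a) (𝓝[>] 0) atBot) (hz : IsRectifiedPath Ω p₀ p₁ x z)
    (hz' : IsRectifiedPath Ω p₀ p₁ x' z') (hη : 0 < η) (hxx : ‖x - x'‖ ≤ η) (hε : 0 < ε)
    (hx : x ∈ erosion Ω ε) (hx' : x' ∈ erosion Ω ε) {A : ℝ}
    (hA : A = velocityConst d (Metric.diam Ω) (omegaInvOne Ω p₀ p₁))
    {t : ℝ} (ht : t ∈ Icc (0 : ℝ) 1) :
    ‖z t - z' t‖ ≤ globalModulus Ω p₀ p₁ a A (2 * A) ε η := by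
  have hA0 : 0 < A := hA ▸ velocityConst_pos _ _ _
  have hlog := log_diam_div_nonneg hd H.compact.isBounded hε hx
  have hD : 0 ≤ Metric.diam Ω := Metric.diam_nonneg
  rw [globalModulus, if_neg hη.ne']
  set Q := 2 * A / ε * Real.log (Metric.diam Ω / ε)
  have hQ : 0 ≤ Q := by positivity
  have hr := H.PsiInv_pos ha hΨ (Psi Ω p₀ p₁ a η / 2 + A + Q)
  have hq := H.PsiInv_pos ha hΨ (-2 * (2 * A) / ε)
  rcases le_or_gt (PsiInv Ω p₀ p₁ a (-2 * (2 * A) / ε)) η with hlarge | hsmall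
  · refine le_add_of_nonneg_of_le hr.le (le_trans ?_
      (le_mul_of_one_le_right hD (((one_le_div hq).2 hlarge).trans (le_max_right _ _))))
    rw [← dist_eq_norm]
    exact Metric.dist_le_diam_of_mem H.compact.isBounded (H.path_mem hz ht) (H.path_mem hz' ht)
  · rw [H.lt_PsiInv_iff ha hΨ hη] at hsmall
    refine (H.norm_path_sub_path_le_of_Psi_le ha hz hz' hη hxx hε hx hx' hr hA
      (hsmall.le.trans_eq (by ring)) ?_ ht).trans ?_
    · rw [H.Psi_PsiInv ha hΨ]
      linarith
    · rw [show 2 * Metric.diam Ω * (4 * A / (4 * A - ε * Psi Ω p₀ p₁ a η)) = Metric.diam Ω *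
        (4 * (2 * A) / (2 * (2 * A) - ε * Psi Ω p₀ p₁ a η)) by ring_nf]
      gcongr
      exact le_max_left _ _

lemma path_mem_erosion_of_end (hd : 1 ≤ d) {γ : ℝ} (hz : IsRectifiedPath Ω p₀ p₁ x z) (hε : 0 < ε)
    (hx : x ∈ erosion Ω ε) (hγ : 0 ≤ γ) (hend : z 1 ∈ erosion Ω γ) {t : ℝ}
    (ht : t ∈ Ico (0 : ℝ) 1) : z t ∈ erosion Ω (γ * ε / (2 * Metric.diam Ω)) := by
  have hεD := two_mul_le_diam_of_mem_erosion hd H.compact.isBounded hε.le hx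
  have hD : 0 < Metric.diam Ω := by linarith
  rcases le_total (γ / (2 * Metric.diam Ω)) (1 - t) with hearly | hlate
  · refine erosion_anti ?_ (H.path_mem_erosion hz hx ht)
    rw [mul_div_right_comm]
    gcongr
  · refine (Metric.closedBall_subset_closedBall' ?_).trans hend
    have hspeed : dist (z t) (z 1) ≤ γ / 2 :=
      calc dist (z t) (z 1) ≤ Metric.diam Ω * (1 - t) := by
            rw [dist_comm, dist_eq_norm, ← abs_of_pos (sub_pos.2 ht.2)]
            exact H.norm_path_sub_le hz (Ico_subset_Icc_self ht) (right_mem_Icc.2 zero_le_one)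
        _ ≤ Metric.diam Ω * (γ / (2 * Metric.diam Ω)) := by gcongr
        _ = γ / 2 := by field_simp
    have hhalf : γ * ε / (2 * Metric.diam Ω) ≤ γ / 2 := by
      rw [div_le_iff₀ (by positivity)]
      nlinarith
    linarith

lemma norm_path_sub_path_le_awayModulus (hd : 1 ≤ d) {γ K₂ K₃ : ℝ} (ha : 0 < a)
    (hΨ : Tendsto (Psi Ω p₀ p₁ a) (𝓝[>] 0) atBot) (hz : IsRectifiedPath Ω p₀ p₁ x z)
    (hz' : IsRectifiedPath Ω p₀ p₁ x' z') (hη : 0 < η) (hxx : ‖x - x'‖ ≤ η) (hε : 0 < ε)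
    (hx : x ∈ erosion Ω ε) (hx' : x' ∈ erosion Ω ε) (hγ : 0 < γ) (hend : z 1 ∈ erosion Ω γ)
    (hend' : z' 1 ∈ erosion Ω γ) {A : ℝ}
    (hA : A = velocityConst d (Metric.diam Ω) (omegaInvOne Ω p₀ p₁)) (hK₂ : 0 ≤ K₂)
    (hK₃ : 2 * Metric.diam Ω * A ≤ K₃) {t : ℝ} (ht : t ∈ Icc (0 : ℝ) 1) :
    ‖z t - z' t‖ ≤ awayModulus Ω p₀ p₁ a A K₂ K₃ ε γ η := by
  have hlog := log_diam_div_nonneg hd H.compact.isBounded hε hx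
  have hεD := two_mul_le_diam_of_mem_erosion hd H.compact.isBounded hε.le hx
  have hD : 0 < Metric.diam Ω := by linarith
  rw [awayModulus, if_neg hη.ne']
  refine H.norm_path_sub_path_le ha hz hz' hη hxx (by positivity) le_rfl
    (fun t ht => H.path_mem_erosion_of_end hd hz hε hx hγ.le hend ht)
    (fun t ht => H.path_mem_erosion_of_end hd hz' hε hx' hγ.le hend' ht)
    (H.PsiInv_pos ha hΨ _) ?_ t ht
  have hcost : A * (1 + 1 / (γ * ε / (2 * Metric.diam Ω))) =
      A + 2 * Metric.diam Ω * A / (ε * γ) := by field_simp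
  have hK₃' : 2 * Metric.diam Ω * A / (ε * γ) ≤ K₃ / (ε * γ) := by gcongr
  have hmin : 0 ≤ K₂ / min ε γ * Real.log (Metric.diam Ω / ε) := by
    have := lt_min hε hγ
    positivity
  rw [H.Psi_PsiInv ha hΨ, awayExponent, ← hA, hcost]
  linarith

lemma PsiInv_Psi_add_le_exp_mul {L Q : ℝ} (ha : 0 < a)
    (hΨ : Tendsto (Psi Ω p₀ p₁ a) (𝓝[>] 0) atBot) (hη : 0 < η) (hL : 0 ≤ L) (hQ : 0 ≤ Q)
    (hω : ∀ s, 0 ≤ s → omega Ω p₀ p₁ s ≤ L * s) :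
    PsiInv Ω p₀ p₁ a (Psi Ω p₀ p₁ a η + Q) ≤ Real.exp ((1 + L) * Q) * η := by
  set r := PsiInv Ω p₀ p₁ a (Psi Ω p₀ p₁ a η + Q)
  have hr : 0 < r := H.PsiInv_pos ha hΨ _
  have hΨr : Psi Ω p₀ p₁ a r = Psi Ω p₀ p₁ a η + Q := H.Psi_PsiInv ha hΨ _
  have hηr : η ≤ r := ((H.strictMonoOn_Psi ha).le_iff_le hη hr).1 (by linarith)
  have hlog : Real.log (r / η) / (1 + L) ≤ Psi Ω p₀ p₁ a r - Psi Ω p₀ p₁ a η :=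
    H.isModulus_velocityModulus.log_div_le_osgoodPrimitive_sub ha hη hηr fun s hs => by
      rw [velocityModulus]
      linarith [hω s (hη.le.trans hs.1)]
  rwa [hΨr, add_sub_cancel_left, div_le_iff₀ (by positivity),
    Real.log_le_iff_le_exp (by positivity), div_le_iff₀ hη, mul_comm Q] at hlog

lemma exists_omega_le_mul {K : NNReal} (h₀ : LipschitzOnWith K p₀ Ω)
    (h₁ : LipschitzOnWith K p₁ Ω) : ∃ L ≥ 0, ∀ η, 0 ≤ η → omega Ω p₀ p₁ η ≤ L * η := by
  obtain ⟨c₀, hc₀, hp₀⟩ := H.left.bounded_below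
  obtain ⟨c₁, hc₁, hp₁⟩ := H.right.bounded_below
  refine ⟨max (K / c₀) (K / c₁), le_max_of_le_left (by positivity), fun η hη =>
    omega_le (by positivity) fun x hx y hy hxy => max_le ?_ ?_⟩
  · exact (abs_div_sub_one_le_of_lipschitzOnWith hc₀ hp₀ h₀ hx hy).trans <|
      mul_le_mul (le_max_left _ _) hxy (norm_nonneg _) (by positivity)
  · exact (abs_div_sub_one_le_of_lipschitzOnWith hc₁ hp₁ h₁ hx hy).trans <|
      mul_le_mul (le_max_right _ _) hxy (norm_nonneg _) (by positivity)

end Admissible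

/-! ### The rectified flow -/

namespace Admissible

variable (H : Admissible Ω p₀ p₁) {a ε γ : ℝ} {x x' : E d}
include H

lemma isRectifiedPath_rectifiedFlow (ha : 0 < a) (hΨ : Tendsto (Psi Ω p₀ p₁ a) (𝓝[>] 0) atBot)
    (hx : x ∈ interior Ω) :
    IsRectifiedPath Ω p₀ p₁ x (fun t => rectifiedFlow Ω p₀ p₁ t x) :=
  Classical.epsilon_spec (H.exists_isRectifiedPath ha hΨ hx)

theorem uniformEquicontinuousOn_rectifiedFlow (ha : 0 < a)
    (hΨ : Tendsto (Psi Ω p₀ p₁ a) (𝓝[>] 0) atBot) (hε : 0 < ε) :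
    UniformEquicontinuousOn (fun (t : Icc (0 : ℝ) 1) x => rectifiedFlow Ω p₀ p₁ t x)
      (erosion Ω ε) := by
  intro U hU
  obtain ⟨r, hr, hrU⟩ := Metric.mem_uniformity_dist.1 hU
  obtain ⟨η, hη, hclose⟩ := H.exists_norm_path_sub_path_le ha hΨ hε (half_pos hr)
  rw [eventually_inf_principal]
  filter_upwards [Metric.dist_mem_uniformity hη] with q hq hqΩ t
  have hpath : ∀ x ∈ erosion Ω ε, IsRectifiedPath Ω p₀ p₁ x (fun t => rectifiedFlow Ω p₀ p₁ t x) :=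
    fun x hx => H.isRectifiedPath_rectifiedFlow ha hΨ (erosion_subset_interior hε hx)
  have hpts : ‖q.1 - q.2‖ < η := by
    rw [← dist_eq_norm]
    exact hq
  refine hrU ((dist_eq_norm _ _).trans_lt (lt_of_le_of_lt ?_ (half_lt_self hr)))
  exact hclose q.1 q.2 _ _ (hpath _ hqΩ.1) (hpath _ hqΩ.2) hqΩ.1 hqΩ.2 hpts.le t t.2

theorem norm_rectifiedFlow_sub_le_globalModulus (hd : 1 ≤ d) (ha : 0 < a)
    (hΨ : Tendsto (Psi Ω p₀ p₁ a) (𝓝[>] 0) atBot) (hε : 0 < ε) (hx : x ∈ erosion Ω ε)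
    (hx' : x' ∈ erosion Ω ε) {A : ℝ}
    (hA : A = velocityConst d (Metric.diam Ω) (omegaInvOne Ω p₀ p₁)) {η : ℝ} (hη : 0 ≤ η)
    (hxx : ‖x - x'‖ ≤ η) {t : ℝ} (ht : t ∈ Icc (0 : ℝ) 1) :
    ‖rectifiedFlow Ω p₀ p₁ t x - rectifiedFlow Ω p₀ p₁ t x'‖ ≤
      globalModulus Ω p₀ p₁ a A (2 * A) ε η := by
  rcases hη.eq_or_lt with rfl | hη
  · obtain rfl : x = x' := sub_eq_zero.1 (norm_le_zero_iff.1 hxx)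
    simp [globalModulus]
  · exact H.norm_path_sub_path_le_globalModulus hd ha hΨ
      (H.isRectifiedPath_rectifiedFlow ha hΨ (erosion_subset_interior hε hx))
      (H.isRectifiedPath_rectifiedFlow ha hΨ (erosion_subset_interior hε hx')) hη hxx hε hx hx'
      hA ht

lemma rectifiedFlow_one_mem_erosion (ha : 0 < a) (hΨ : Tendsto (Psi Ω p₀ p₁ a) (𝓝[>] 0) atBot)
    (hε : 0 < ε) (hx : x ∈ erosion Ω ε \ nearBoundary Ω p₀ p₁ γ) :
    rectifiedFlow Ω p₀ p₁ 1 x ∈ erosion Ω γ := by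
  have hxi : x ∈ interior Ω := erosion_subset_interior hε hx.1
  refine mem_erosion_of_lt_infDist_frontier
    (H.path_mem (H.isRectifiedPath_rectifiedFlow ha hΨ hxi) (right_mem_Icc.2 zero_le_one)) ?_
  by_contra h
  exact hx.2 ⟨interior_subset hxi, not_lt.1 h⟩

variable {A K₂ K₃ : ℝ}

theorem norm_rectifiedFlow_sub_le_awayModulus (hd : 1 ≤ d) (ha : 0 < a)
    (hΨ : Tendsto (Psi Ω p₀ p₁ a) (𝓝[>] 0) atBot) (hε : 0 < ε) (hγ : 0 < γ)
    (hA : A = velocityConst d (Metric.diam Ω) (omegaInvOne Ω p₀ p₁)) (hK₂ : 0 ≤ K₂)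
    (hK₃ : 2 * Metric.diam Ω * A ≤ K₃) (hx : x ∈ erosion Ω ε \ nearBoundary Ω p₀ p₁ γ)
    (hx' : x' ∈ erosion Ω ε \ nearBoundary Ω p₀ p₁ γ) {η : ℝ} (hη : 0 ≤ η) (hxx : ‖x - x'‖ ≤ η)
    {t : ℝ} (ht : t ∈ Icc (0 : ℝ) 1) :
    ‖rectifiedFlow Ω p₀ p₁ t x - rectifiedFlow Ω p₀ p₁ t x'‖ ≤
      awayModulus Ω p₀ p₁ a A K₂ K₃ ε γ η := by
  rcases hη.eq_or_lt with rfl | hη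
  · obtain rfl : x = x' := sub_eq_zero.1 (norm_le_zero_iff.1 hxx)
    simp [awayModulus]
  · exact H.norm_path_sub_path_le_awayModulus hd ha hΨ
      (H.isRectifiedPath_rectifiedFlow ha hΨ (erosion_subset_interior hε hx.1))
      (H.isRectifiedPath_rectifiedFlow ha hΨ (erosion_subset_interior hε hx'.1)) hη hxx hε hx.1
      hx'.1 hγ (H.rectifiedFlow_one_mem_erosion ha hΨ hε hx)
      (H.rectifiedFlow_one_mem_erosion ha hΨ hε hx') hA hK₂ hK₃ ht

theorem norm_rectifiedFlow_sub_le_exp_mul (hd : 1 ≤ d) (ha : 0 < a)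
    (hΨ : Tendsto (Psi Ω p₀ p₁ a) (𝓝[>] 0) atBot) (hε : 0 < ε) (hγ : 0 < γ)
    (hA : A = velocityConst d (Metric.diam Ω) (omegaInvOne Ω p₀ p₁)) (hK₂ : 0 ≤ K₂)
    (hK₃ : 2 * Metric.diam Ω * A ≤ K₃) (hx : x ∈ erosion Ω ε \ nearBoundary Ω p₀ p₁ γ)
    (hx' : x' ∈ erosion Ω ε \ nearBoundary Ω p₀ p₁ γ) {L : ℝ} (hL : 0 ≤ L)
    (hω : ∀ η, 0 ≤ η → omega Ω p₀ p₁ η ≤ L * η) {t : ℝ} (ht : t ∈ Icc (0 : ℝ) 1) :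
    ‖rectifiedFlow Ω p₀ p₁ t x - rectifiedFlow Ω p₀ p₁ t x'‖ ≤
      Real.exp ((1 + L) * awayExponent Ω A K₂ K₃ ε γ) * ‖x - x'‖ := by
  rcases eq_or_ne x x' with rfl | hne
  · simp
  have hη : 0 < ‖x - x'‖ := norm_sub_pos_iff.2 hne
  have hA0 : 0 ≤ A := hA ▸ (velocityConst_pos _ _ _).le
  have hK₃0 : 0 ≤ K₃ := (mul_nonneg (mul_nonneg two_pos.le Metric.diam_nonneg) hA0).trans hK₃
  have hmod := H.norm_rectifiedFlow_sub_le_awayModulus hd ha hΨ hε hγ hA hK₂ hK₃ hx hx' hη.le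
    le_rfl ht
  rw [awayModulus, if_neg hη.ne'] at hmod
  exact hmod.trans (H.PsiInv_Psi_add_le_exp_mul ha hΨ hη hL
    (awayExponent_nonneg hd H.compact.isBounded hA0 hK₂ hK₃0 hε hγ hx.1) hω)

theorem exists_lipschitzOnWith_rectifiedFlow (hd : 1 ≤ d) (ha : 0 < a)
    (hΨ : Tendsto (Psi Ω p₀ p₁ a) (𝓝[>] 0) atBot) (hε : 0 < ε) (hγ : 0 < γ) {K : NNReal}
    (h₀ : LipschitzOnWith K p₀ Ω) (h₁ : LipschitzOnWith K p₁ Ω) :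
    ∃ M : NNReal, ∀ t ∈ Icc (0 : ℝ) 1,
      LipschitzOnWith M (rectifiedFlow Ω p₀ p₁ t) (erosion Ω ε \ nearBoundary Ω p₀ p₁ γ) := by
  obtain ⟨L, hL, hω⟩ := H.exists_omega_le_mul h₀ h₁
  set A := velocityConst d (Metric.diam Ω) (omegaInvOne Ω p₀ p₁)
  refine ⟨⟨Real.exp ((1 + L) * awayExponent Ω A 0 (2 * Metric.diam Ω * A) ε γ),
    (Real.exp_pos _).le⟩, fun t ht => LipschitzOnWith.of_dist_le_mul fun x hx x' hx' => ?_⟩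
  rw [dist_eq_norm, dist_eq_norm]
  exact H.norm_rectifiedFlow_sub_le_exp_mul hd ha hΨ hε hγ rfl le_rfl le_rfl hx hx' hL hω ht

end Admissible

end RectifiedFlow

end

theorem mainTheorem8 (d : ℕ) (hd : 1 ≤ d) (D w : ℝ) :
    ∃ C₁ C₂ K₁ K₂ K₃ : ℝ, 0 < C₁ ∧ 0 < C₂ ∧ 0 < K₁ ∧ 0 < K₂ ∧ 0 < K₃ ∧
      ∀ (Ω : Set (RectifiedFlow.E d)) (p₀ p₁ : RectifiedFlow.E d → ℝ) (a : ℝ),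
        IsCompact Ω → Convex ℝ Ω → (interior Ω).Nonempty →
        RectifiedFlow.IsRegularDensity Ω p₀ → RectifiedFlow.IsRegularDensity Ω p₁ →
        0 < a →
        Tendsto (RectifiedFlow.Psi Ω p₀ p₁ a) (𝓝[>] 0) atBot →
        Metric.diam Ω = D → RectifiedFlow.omegaInvOne Ω p₀ p₁ = w →
        -- the flow is the unique solution of the integral equation
        (∀ x ∈ interior Ω,
          RectifiedFlow.IsRectifiedPath Ω p₀ p₁ x
            (fun t => RectifiedFlow.rectifiedFlow Ω p₀ p₁ t x) ∧
          ∀ z : ℝ → RectifiedFlow.E d, RectifiedFlow.IsRectifiedPath Ω p₀ p₁ x z →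
            ∀ t ∈ Icc (0 : ℝ) 1, z t = RectifiedFlow.rectifiedFlow Ω p₀ p₁ t x) ∧
        ∀ ε : ℝ, 0 < ε →
          -- uniform continuity on `Ω^{-ε}`, uniformly in `t`
          UniformEquicontinuousOn
            (fun (t : Icc (0 : ℝ) 1) (x : RectifiedFlow.E d) =>
              RectifiedFlow.rectifiedFlow Ω p₀ p₁ t x)
            (RectifiedFlow.erosion Ω ε) ∧
          -- the explicit modulus on `Ω^{-ε}`
          (∀ η : ℝ, 0 ≤ η → ∀ t ∈ Icc (0 : ℝ) 1,
            ∀ x ∈ RectifiedFlow.erosion Ω ε, ∀ x' ∈ RectifiedFlow.erosion Ω ε, ‖x - x'‖ ≤ η →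
              ‖RectifiedFlow.rectifiedFlow Ω p₀ p₁ t x -
                  RectifiedFlow.rectifiedFlow Ω p₀ p₁ t x'‖ ≤
                RectifiedFlow.globalModulus Ω p₀ p₁ a C₁ C₂ ε η) ∧
          -- the sharper modulus away from `𝒜_γ`
          ∀ γ : ℝ, 0 < γ → γ ≤ Metric.diam Ω / 2 →
            (∀ η : ℝ, 0 ≤ η → ∀ t ∈ Icc (0 : ℝ) 1,
              ∀ x ∈ RectifiedFlow.erosion Ω ε \ RectifiedFlow.nearBoundary Ω p₀ p₁ γ,
              ∀ x' ∈ RectifiedFlow.erosion Ω ε \ RectifiedFlow.nearBoundary Ω p₀ p₁ γ,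
                ‖x - x'‖ ≤ η →
                ‖RectifiedFlow.rectifiedFlow Ω p₀ p₁ t x -
                    RectifiedFlow.rectifiedFlow Ω p₀ p₁ t x'‖ ≤
                  RectifiedFlow.awayModulus Ω p₀ p₁ a K₁ K₂ K₃ ε γ η) ∧
            -- which is a Lipschitz bound when `ω` is linearly bounded
            (∀ L : ℝ, 0 ≤ L → (∀ η : ℝ, 0 ≤ η → RectifiedFlow.omega Ω p₀ p₁ η ≤ L * η) →
              ∀ t ∈ Icc (0 : ℝ) 1,
              ∀ x ∈ RectifiedFlow.erosion Ω ε \ RectifiedFlow.nearBoundary Ω p₀ p₁ γ,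
              ∀ x' ∈ RectifiedFlow.erosion Ω ε \ RectifiedFlow.nearBoundary Ω p₀ p₁ γ,
                ‖RectifiedFlow.rectifiedFlow Ω p₀ p₁ t x -
                    RectifiedFlow.rectifiedFlow Ω p₀ p₁ t x'‖ ≤
                  Real.exp ((1 + L) * RectifiedFlow.awayExponent Ω K₁ K₂ K₃ ε γ) *
                    ‖x - x'‖) ∧
            -- in particular when the densities are Lipschitz
            ((∃ K : NNReal, LipschitzOnWith K p₀ Ω ∧ LipschitzOnWith K p₁ Ω) →
              ∃ M : NNReal, ∀ t ∈ Icc (0 : ℝ) 1,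
                LipschitzOnWith M (RectifiedFlow.rectifiedFlow Ω p₀ p₁ t)
                  (RectifiedFlow.erosion Ω ε \ RectifiedFlow.nearBoundary Ω p₀ p₁ γ)) := by
  set A := RectifiedFlow.velocityConst d D w with hA
  have hA0 : 0 < A := RectifiedFlow.velocityConst_pos d D w
  refine ⟨A, 2 * A, A, 1, 2 * |D| * A + 1, hA0, by positivity, hA0, one_pos, by positivity, ?_⟩
  rintro Ω p₀ p₁ a hcompact hconvex - hp₀ hp₁ ha hΨ rfl rfl
  have H : RectifiedFlow.Admissible Ω p₀ p₁ := ⟨hcompact, hconvex, hp₀, hp₁⟩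
  refine ⟨fun x hx => ?_, fun ε hε => ⟨H.uniformEquicontinuousOn_rectifiedFlow ha hΨ hε,
    fun η hη t ht x hx x' hx' hxx =>
      H.norm_rectifiedFlow_sub_le_globalModulus hd ha hΨ hε hx hx' hA hη hxx ht,
    fun γ hγ _ => ?_⟩⟩
  · have hflow := H.isRectifiedPath_rectifiedFlow ha hΨ hx
    exact ⟨hflow, fun z hz t ht => H.path_unique ha hΨ hx hz hflow ht⟩
  · have hK₃ : 2 * Metric.diam Ω * A ≤ 2 * |Metric.diam Ω| * A + 1 := by
      rw [abs_of_nonneg Metric.diam_nonneg]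
      linarith
    refine ⟨fun η hη t ht x hx x' hx' hxx => ?_, fun L hL hω t ht x hx x' hx' => ?_, ?_⟩
    · exact H.norm_rectifiedFlow_sub_le_awayModulus hd ha hΨ hε hγ hA one_pos.le hK₃ hx hx' hη
        hxx ht
    · exact H.norm_rectifiedFlow_sub_le_exp_mul hd ha hΨ hε hγ hA one_pos.le hK₃ hx hx' hL hω ht
    · rintro ⟨K, h₀, h₁⟩
      exact H.exists_lipschitzOnWith_rectifiedFlow hd ha hΨ hε hγ h₀ h₁
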